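/- Let $\mathbb F$ be an algebraically closed field of characteristic zero. For a Lie algebra $\mathfrak g$ over $\mathbb F$ put $\mathfrak g^0=\mathfrak g$, $\mathfrak g^{k+1}=[\mathfrak g,\mathfrak g^{k}]$; let $C_1(\mathfrak g)$ be the centre of $\mathfrak g$ and let $C_{k+1}(\mathfrak g)$ be the preimage in $\mathfrak g$ of the centre of $\mathfrak g/C_{k}(\mathfrak g)$; and define the ideals $$\mathfrak i(\mathfrak g)=\sum_{k\ge 1}C_k(\mathfrak g)\cap\mathfrak g^k,\qquad \mathfrak j(\mathfrak g)=\bigcap_{k\ge 1}\bigl(C_k(\mathfrak g)+\mathfrak g^k\bigr).$$ An invariant metric on $\mathfrak g$ is a non-degenerate symmetric bilinear form $B$ with $B([x,y],z)=B(x,[y,z])$; the pair $(\mathfrak g,B)$ is then called a quadratic Lie algebra, and an isometry of quadratic Lie algebras is a Lie algebra isomorphism that preserves the metrics. Let $\mathfrak h$ be the $3$-dimensional Heisenberg Lie algebra, with basis $x_1,x_2,x_3$ and only non-zero bracket $[x_1,x_2]=x_3$; let $\theta^1,\theta^2,\theta^3$ be the dual basis of $\mathfrak h^*$, let $\mathrm{ad}^*(x)(\alpha)=-\alpha\circ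 \mathrm{ad}(x)$ be the coadjoint representation, and let $\mathfrak a=\mathbb F^3$ with standard basis $v_1,v_2,v_3$. For alternating bilinear maps $\lambda:\mathfrak h\times\mathfrak h\to\mathfrak a$, $\mu:\mathfrak h\times\mathfrak h\to\mathfrak h^*$ and a linear map $\varphi:\mathfrak h\to\mathrm{Hom}(\mathfrak a,\mathfrak h^*)$ such that the following is a Lie bracket, let $\mathfrak h(\lambda,\mu,\varphi)$ be the Lie algebra on $\mathfrak h\oplus\mathfrak a\oplus\mathfrak h^*$ in which $$[x,y]=[x,y]_{\mathfrak h}+\lambda(x,y)+\mu(x,y),\quad [x,v]=\varphi(x)(v),\quad [x,\alpha]=\mathrm{ad}^*(x)(\alpha)\qquad (x,y\in\mathfrak h,\ v\in\mathfrak a,\ \alpha\in\mathfrak h^*)$$ and $\mathfrak a\oplus\mathfrak h^*$ is Abelian. The columns $1,2,3$ of the matrix of $\lambda$ (resp. $\mu$) are the coordinates, with respect to $v_1,v_2,v_3$ (resp. $\theta^1,\theta^2,\theta^3$), of its values at $(x_2,x_3)$, $(x_3,x_1)$, $(x_1,x_2)$; column $\ell$ of the matrix $\varphi^j$ holds the coordinates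 of $\varphi(x_j)(v_\ell)$ with respect to $\theta^1,\theta^2,\theta^3$. Consider the four cases 1. $\lambda=\mathrm{Id}$, $\mu=0$, $\varphi^1=\left(\begin{smallmatrix}0&0&0\\0&0&-1\\0&1&0\end{smallmatrix}\right)$, $\varphi^2=\left(\begin{smallmatrix}0&0&1\\0&0&0\\-1&0&0\end{smallmatrix}\right)$, $\varphi^3=\left(\begin{smallmatrix}0&-1&0\\1&0&0\\0&0&0\end{smallmatrix}\right)$; 2. $\lambda=\left(\begin{smallmatrix}1&0&0\\0&0&0\\0&0&0\end{smallmatrix}\right)$, $\mu=0$, $\varphi^1=0$, $\varphi^2=\left(\begin{smallmatrix}0&0&0\\0&0&0\\-1&0&0\end{smallmatrix}\right)$, $\varphi^3=\left(\begin{smallmatrix}0&0&0\\1&0&0\\0&0&0\end{smallmatrix}\right)$; 3. $\lambda=0$, $\mu=\mathrm{Id}$, $\varphi=0$; 4. $\lambda=0$, $\mu=0$, $\varphi=0$; each with the metric $B_0(x+u+\alpha,\,y+v+\beta)=\alpha(y)+\beta(x)+B_{\mathfrak a}(u,v)$, where $B_{\mathfrak a}$ is the symmetric bilinear form on $\mathfrak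 a$ for which $v_1,v_2,v_3$ is orthonormal. **Proposition.** Let $\mathfrak g$ be a finite-dimensional solvable Lie algebra over $\mathbb F$ such that $\mathfrak g^{\ell}$ is Abelian for some $\ell$, and let $B$ be an invariant metric on $\mathfrak g$. Suppose that $\mathfrak g/\mathfrak j(\mathfrak g)$ is isomorphic to $\mathfrak h$ and that $r=\dim_{\mathbb F}\bigl(\mathfrak j(\mathfrak g)/\mathfrak i(\mathfrak g)\bigr)\ge 3$. Then $(\mathfrak g,B)$ is isometric to the orthogonal direct sum of a quadratic Lie algebra $(\mathfrak h(\lambda,\mu,\varphi),B_0)$ with $(\lambda,\mu,\varphi)$ as in one of the four cases, and an $(r-3)$-dimensional vector space $V$, regarded as an Abelian Lie algebra with a non-degenerate symmetric bilinear form. -/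

import Mathlib

open Module

noncomputable section

/-! ## Invariant metrics -/

/-- An invariant metric on a Lie algebra: a non-degenerate, symmetric bilinear form with
`B([x,y],z) = B(x,[y,z])`.  A quadratic Lie algebra is a Lie algebra with such a form. -/
structure IsInvariantMetric {F g : Type*} [Field F] [LieRing g] [LieAlgebra F g]
    (B : LinearMap.BilinForm F g) : Prop where
  symm : B.IsSymm
  nondegenerate : B.Nondegenerate
  invariant : ∀ x y z : g, B ⁅x, y⁆ z = B x ⁅y, z⁆

/-! ## The canonical ideals -/

/-- The descending central series: `g^0 = g`, `g^(k+1) = [g, g^k]`. -/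
abbrev descendingCentral (F g : Type*) [Field F] [LieRing g] [LieAlgebra F g] (k : ℕ) :
    LieIdeal F g :=
  LieModule.lowerCentralSeries F g g k

/-- The derived (ascending) central series `C_k`: `C_0 = 0` and
`C_(k+1) = {x | [y, x] ∈ C_k for all y}`, the preimage of the centre of `g / C_k`;
in particular `C_1` is the centre of `g`. -/
abbrev ascendingCentral (F g : Type*) [Field F] [LieRing g] [LieAlgebra F g] (k : ℕ) :
    LieIdeal F g :=
  LieSubmodule.ucs k ⊥

/-- `i(g) = ∑_{k ≥ 1} C_k(g) ∩ g^k`. -/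
def canonicalI (F g : Type*) [Field F] [LieRing g] [LieAlgebra F g] : LieIdeal F g :=
  ⨆ k : ℕ, ascendingCentral F g (k + 1) ⊓ descendingCentral F g (k + 1)

/-- `j(g) = ⋂_{k ≥ 1} (C_k(g) + g^k)`. -/
def canonicalJ (F g : Type*) [Field F] [LieRing g] [LieAlgebra F g] : LieIdeal F g :=
  ⨅ k : ℕ, ascendingCentral F g (k + 1) ⊔ descendingCentral F g (k + 1)

/-! ## The Heisenberg algebra -/

/-- The three-dimensional Heisenberg Lie algebra: coordinates with respect to a basis
`x₁, x₂, x₃` whose only non-zero bracket is `[x₁, x₂] = x₃`. -/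
def Heisenberg (F : Type*) : Type _ := Fin 3 → F

namespace Heisenberg

instance (F : Type*) [Field F] : AddCommGroup (Heisenberg F) :=
  inferInstanceAs (AddCommGroup (Fin 3 → F))

instance (F : Type*) [Field F] : Module F (Heisenberg F) :=
  inferInstanceAs (Module F (Fin 3 → F))

instance (F : Type*) [Field F] : Bracket (Heisenberg F) (Heisenberg F) where
  bracket x y := fun i => if i = 2 then x 0 * y 1 - x 1 * y 0 else 0

theorem bracket_apply {F : Type*} [Field F] (x y : Heisenberg F) (i : Fin 3) :
    ⁅x, y⁆ i = if i = 2 then x 0 * y 1 - x 1 * y 0 else 0 := rfl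

theorem add_apply {F : Type*} [Field F] (x y : Heisenberg F) (i : Fin 3) :
    (x + y) i = x i + y i := rfl

theorem smul_apply {F : Type*} [Field F] (c : F) (x : Heisenberg F) (i : Fin 3) :
    (c • x) i = c * x i := rfl

theorem zero_apply {F : Type*} [Field F] (i : Fin 3) : (0 : Heisenberg F) i = 0 := rfl

@[ext] theorem ext {F : Type*} {x y : Heisenberg F} (h : ∀ i, x i = y i) : x = y := funext h

instance (F : Type*) [Field F] : LieRing (Heisenberg F) where
  add_lie x y z := by
    ext i; simp only [bracket_apply, add_apply]; split_ifs <;> ring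
  lie_add x y z := by
    ext i; simp only [bracket_apply, add_apply]; split_ifs <;> ring
  lie_self x := by
    ext i; simp only [bracket_apply, zero_apply]; split_ifs <;> ring
  leibniz_lie x y z := by
    ext i; simp only [bracket_apply, add_apply]; split_ifs <;> simp_all

instance (F : Type*) [Field F] : LieAlgebra F (Heisenberg F) where
  lie_smul c x y := by
    ext i; simp only [bracket_apply, smul_apply]; split_ifs <;> ring

/-- The basis `x₁, x₂, x₃` (indexed by `0, 1, 2`). -/
def basisVec (F : Type*) [Field F] (i : Fin 3) : Heisenberg F := Pi.single i 1

/-- The dual basis `θ¹, θ², θ³`. -/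
def dualVec (F : Type*) [Field F] (i : Fin 3) : Dual F (Heisenberg F) :=
  (LinearMap.proj i : (Fin 3 → F) →ₗ[F] F)

end Heisenberg

/-! ## The Lie algebras `h(λ, μ, φ)` on `h ⊕ a ⊕ h*` -/

/-- Data `(λ, μ, φ)` on a Lie algebra `h` and a vector space `a` (a trivial `h`-module):
`λ` and `μ` are 2-cochains of `h` with values in `a` and in `h*` (the coadjoint module, whose
action `⁅x, α⁆ = -α ∘ ad x` is Mathlib's), `φ` is a linear map `h → Hom(a, h*)`, and
`dφ = 0`, `dλ = 0`, `dμ + e_φ(λ) = 0`. -/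
structure ExtensionData (F h a : Type*) [Field F] [LieRing h] [LieAlgebra F h]
    [AddCommGroup a] [Module F a] where
  lam : h →ₗ[F] h →ₗ[F] a
  mu : h →ₗ[F] h →ₗ[F] Dual F h
  phi : h →ₗ[F] a →ₗ[F] Dual F h
  lam_self : ∀ x, lam x x = 0
  mu_self : ∀ x, mu x x = 0
  phi_cocycle : ∀ x y v, phi ⁅x, y⁆ v = ⁅x, phi y v⁆ - ⁅y, phi x v⁆
  lam_cocycle : ∀ x y z, lam ⁅x, y⁆ z + lam ⁅y, z⁆ x + lam ⁅z, x⁆ y = 0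
  mu_cocycle : ∀ x y z,
    (⁅x, mu y z⁆ + ⁅y, mu z x⁆ + ⁅z, mu x y⁆)
      - (mu ⁅x, y⁆ z + mu ⁅y, z⁆ x + mu ⁅z, x⁆ y)
      + (phi x (lam y z) + phi y (lam z x) + phi z (lam x y)) = 0

namespace ExtensionData

variable {F h a : Type*} [Field F] [LieRing h] [LieAlgebra F h] [AddCommGroup a] [Module F a]

/-- The underlying vector space `h ⊕ a ⊕ h*` of the Lie algebra `h(λ, μ, φ)`. -/
def Algebra (_D : ExtensionData F h a) : Type _ := h × a × Dual F h

instance (D : ExtensionData F h a) : AddCommGroup D.Algebra :=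
  inferInstanceAs (AddCommGroup (h × a × Dual F h))

instance (D : ExtensionData F h a) : Module F D.Algebra :=
  inferInstanceAs (Module F (h × a × Dual F h))

/-- The component along `h` of an element of `h ⊕ a ⊕ h*`. -/
def toH (D : ExtensionData F h a) : D.Algebra →ₗ[F] h :=
  LinearMap.fst F h (a × Dual F h)

/-- The component along `a` of an element of `h ⊕ a ⊕ h*`. -/
def toA (D : ExtensionData F h a) : D.Algebra →ₗ[F] a :=
  LinearMap.fst F a (Dual F h) ∘ₗ LinearMap.snd F h (a × Dual F h)

/-- The component along `h*` of an element of `h ⊕ a ⊕ h*`. -/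
def toDual (D : ExtensionData F h a) : D.Algebra →ₗ[F] Dual F h :=
  LinearMap.snd F a (Dual F h) ∘ₗ LinearMap.snd F h (a × Dual F h)

/-- The element `x + v + α` of `h ⊕ a ⊕ h*`. -/
def elt (D : ExtensionData F h a) (x : h) (v : a) (α : Dual F h) : D.Algebra := (x, v, α)

@[simp] theorem toH_elt (D : ExtensionData F h a) (x : h) (v : a) (α : Dual F h) :
    D.toH (D.elt x v α) = x := rfl
@[simp] theorem toA_elt (D : ExtensionData F h a) (x : h) (v : a) (α : Dual F h) :
    D.toA (D.elt x v α) = v := rfl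
@[simp] theorem toDual_elt (D : ExtensionData F h a) (x : h) (v : a) (α : Dual F h) :
    D.toDual (D.elt x v α) = α := rfl

@[ext] theorem Algebra.ext {D : ExtensionData F h a} {p q : D.Algebra}
    (h₁ : D.toH p = D.toH q) (h₂ : D.toA p = D.toA q) (h₃ : D.toDual p = D.toDual q) : p = q :=
  Prod.ext h₁ (Prod.ext h₂ h₃)

/-- The bracket of `h(λ, μ, φ)`: `[x, y] = [x, y]_h + λ(x, y) + μ(x, y)`, `[x, v] = φ(x)(v)`,
`[x, α] = ad*(x)(α)`, and `a ⊕ h*` is Abelian. -/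
instance (D : ExtensionData F h a) : Bracket D.Algebra D.Algebra where
  bracket p q :=
    D.elt ⁅D.toH p, D.toH q⁆ (D.lam (D.toH p) (D.toH q))
      (D.mu (D.toH p) (D.toH q)
        + (D.phi (D.toH p) (D.toA q) - D.phi (D.toH q) (D.toA p))
        + (⁅D.toH p, D.toDual q⁆ - ⁅D.toH q, D.toDual p⁆))

theorem bracket_def (D : ExtensionData F h a) (p q : D.Algebra) :
    ⁅p, q⁆ = D.elt ⁅D.toH p, D.toH q⁆ (D.lam (D.toH p) (D.toH q))
      (D.mu (D.toH p) (D.toH q)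
        + (D.phi (D.toH p) (D.toA q) - D.phi (D.toH q) (D.toA p))
        + (⁅D.toH p, D.toDual q⁆ - ⁅D.toH q, D.toDual p⁆)) := rfl

theorem lam_swap (D : ExtensionData F h a) (x y : h) : D.lam x y = - D.lam y x := by
  have e := D.lam_self (x + y)
  simp only [map_add, LinearMap.add_apply, D.lam_self, zero_add, add_zero] at e
  exact eq_neg_of_add_eq_zero_right e

theorem mu_swap (D : ExtensionData F h a) (x y : h) : D.mu x y = - D.mu y x := by
  have e := D.mu_self (x + y)
  simp only [map_add, LinearMap.add_apply, D.mu_self, zero_add, add_zero] at e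
  exact eq_neg_of_add_eq_zero_right e

instance (D : ExtensionData F h a) : LieRing D.Algebra where
  add_lie p q s := by
    ext1 <;> simp only [bracket_def, toH_elt, toA_elt, toDual_elt, add_lie, lie_add, map_add,
      LinearMap.add_apply]
    abel
  lie_add p q s := by
    ext1 <;> simp only [bracket_def, toH_elt, toA_elt, toDual_elt, add_lie, lie_add, map_add,
      LinearMap.add_apply]
    abel
  lie_self p := by
    ext1 <;> simp [bracket_def, D.lam_self, D.mu_self]
  leibniz_lie p q s := by
    ext1
    · simp only [bracket_def, toH_elt, map_add]
      exact leibniz_lie _ _ _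
    · have e := D.lam_cocycle (D.toH p) (D.toH q) (D.toH s)
      simp only [bracket_def, toH_elt, toA_elt, map_add]
      rw [D.lam_swap (D.toH p) ⁅D.toH q, D.toH s⁆, D.lam_swap (D.toH q) ⁅D.toH p, D.toH s⁆,
        ← lie_skew (D.toH p) (D.toH s)]
      simp only [map_neg, LinearMap.neg_apply, neg_neg]
      rw [← sub_eq_zero, ← neg_eq_zero, ← e]
      abel
    · have e := D.mu_cocycle (D.toH p) (D.toH q) (D.toH s)
      simp only [bracket_def, toH_elt, toA_elt, toDual_elt, map_add]
      rw [D.mu_swap (D.toH p) ⁅D.toH q, D.toH s⁆, D.mu_swap (D.toH q) ⁅D.toH p, D.toH s⁆]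
      rw [D.lam_swap (D.toH s) (D.toH p), D.mu_swap (D.toH s) (D.toH p),
        ← lie_skew (D.toH s) (D.toH p)] at e
      simp only [map_neg, LinearMap.neg_apply, lie_neg, lie_add, lie_sub,
        D.phi_cocycle, lie_lie] at e ⊢
      rw [← sub_eq_zero, ← e]
      abel

instance (D : ExtensionData F h a) : LieAlgebra F D.Algebra where
  lie_smul c p q := by
    have e : ⁅D.toH p, c • D.toDual q⁆ = c • ⁅D.toH p, D.toDual q⁆ := by
      ext y; simp
    ext1 <;> simp only [bracket_def, toH_elt, toA_elt, toDual_elt, lie_smul, smul_lie, map_smul,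
      LinearMap.smul_apply, smul_add, smul_sub, e]

/-- The bilinear form `B(x + u + α, y + v + β) = α(y) + β(x) + B_a(u, v)` on `h ⊕ a ⊕ h*`. -/
def form (D : ExtensionData F h a) (Ba : LinearMap.BilinForm F a) :
    LinearMap.BilinForm F D.Algebra :=
  LinearMap.mk₂ F
    (fun p q => D.toDual p (D.toH q) + D.toDual q (D.toH p) + Ba (D.toA p) (D.toA q))
    (by intros; simp only [map_add, LinearMap.add_apply]; ring)
    (by intros; simp only [map_smul, LinearMap.smul_apply, smul_eq_mul]; ring)
    (by intros; simp only [map_add, LinearMap.add_apply]; ring)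
    (by intros; simp only [map_smul, LinearMap.smul_apply, smul_eq_mul]; ring)

end ExtensionData

/-! ## The quadratic algebras over the Heisenberg algebra, with `dim a = 3` -/

/-- `D.HasMatrices L M P` says that, for `h` the Heisenberg algebra with basis `x₁, x₂, x₃`
and `a = F³` with standard basis `v₁, v₂, v₃`, the data `(λ, μ, φ)` have matrices `L`, `M`,
`P 0, P 1, P 2`: the columns 1, 2, 3 of `L` and `M` are the coordinates of the values of `λ`
and `μ` at `(x₂, x₃)`, `(x₃, x₁)`, `(x₁, x₂)`, and column `l` of `P j` holds the coordinates of
`φ(x_j)(v_l)` with respect to `θ¹, θ², θ³`. -/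
structure ExtensionData.HasMatrices {F : Type*} [Field F]
    (D : ExtensionData F (Heisenberg F) (Fin 3 → F))
    (L M : Matrix (Fin 3) (Fin 3) F) (P : Fin 3 → Matrix (Fin 3) (Fin 3) F) : Prop where
  lam_eq : ∀ j : Fin 3,
    D.lam (Heisenberg.basisVec F (j + 1)) (Heisenberg.basisVec F (j + 2)) = fun i => L i j
  mu_eq : ∀ j : Fin 3,
    D.mu (Heisenberg.basisVec F (j + 1)) (Heisenberg.basisVec F (j + 2))
      = ∑ i, M i j • Heisenberg.dualVec F i
  phi_eq : ∀ j l : Fin 3,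
    D.phi (Heisenberg.basisVec F j) (Pi.single l 1) = ∑ i, P j i l • Heisenberg.dualVec F i

/-- The four cases of data `(λ, μ, φ)` for which `h(λ, μ, φ)` has an invariant metric. -/
def ExtensionData.IsQuadraticCase {F : Type*} [Field F]
    (D : ExtensionData F (Heisenberg F) (Fin 3 → F)) : Prop :=
  D.HasMatrices 1 0
      ![!![0, 0, 0; 0, 0, -1; 0, 1, 0], !![0, 0, 1; 0, 0, 0; -1, 0, 0],
        !![0, -1, 0; 1, 0, 0; 0, 0, 0]] ∨
  D.HasMatrices !![1, 0, 0; 0, 0, 0; 0, 0, 0] 0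
      ![0, !![0, 0, 0; 0, 0, 0; -1, 0, 0], !![0, 0, 0; 1, 0, 0; 0, 0, 0]] ∨
  D.HasMatrices 0 1 0 ∨
  D.HasMatrices 0 0 0

/-- The symmetric bilinear form on `Fⁿ` for which the standard basis is orthonormal. -/
def standardForm (F : Type*) [Field F] (n : ℕ) : LinearMap.BilinForm F (Fin n → F) :=
  dotProductBilin F F

end

/-!
The metric makes the two central series orthogonal to each other, `C_k = (g^k)^⊥`
(`mem_ascendingCentral_iff`), so `j(g) = i(g)^⊥`.  The stable term of the descending central
series is Abelian, hence isotropic, hence contained in the stable term of the ascending one; so `g`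
is nilpotent (`exists_descendingCentral_eq_bot`).  For nilpotent `g` a telescoping argument gives
`[g, j] ⊆ i` (`lie_mem_canonicalI`), and then invariance gives `[j, j] = 0`.

Now let `g / j` be the Heisenberg algebra.  Its three coordinates are functionals `B(t k, ·)` with
`t 0, t 1, t 2` spanning `i`, and everything else the argument needs from the canonical ideals is
recorded in `IsHeisenbergCoframe`.  Indices run over `Fin 3`, so that `x 0, x 1, x 2` lift the
standard basis `x₁, x₂, x₃`.

Lift the first two basis vectors to `p₀, p₁` and put `q = [p₀, p₁]`.  The Gram matrix of
`[p₀, q]`, `[p₁, q]` depends only on the isomorphism `g / j ≅ h`.  If a vector in the span of these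
two brackets lies in the radical of their Gram matrix, then up to `span t` it is a central element of
`[g, g]`, hence it lies in `i` (`apply_lie_eq_zero_of_gram`); and if both brackets lie in `i`, then
`q - B(q, q) • t 2` is a central element outside `j`, which is impossible
(`not_forall_apply_lie_eq_zero`).  So the Gram matrix is non-zero, and an automorphism of the
Heisenberg algebra brings it to the form `diag(0, 1)` or to the identity
(`exists_normalized_gram`).  Since `B([q, p₁], [q, p₁]) ≠ 0`, a change of the lift gives `B(q, q)`
any prescribed value (`exists_isotropic_lift`).

For `diag(0, 1)` one takes `q` isotropic and puts `x 2 = q`; the only other bracket of lifts is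
`[x 1, x 2] = v 0`, a unit vector.  This is the second case of the classification.  For the identity
one takes `B(q, q) = 1` and splits `q = x 2 + v 2` with `v 2 = w + t 2`, where `w` is a unit vector
orthogonal to everything chosen so far, which exists because `dim (j / i) ≥ 3`.  This is the first
case.  The other two cases do not occur, as there the quotient by `j` is not the Heisenberg
algebra.

Both outcomes are an `IsAdaptedFrame`.  By invariance the bracket of `g` is determined by the
brackets of the lifts `x`, so the coordinates with respect to the frame are a homomorphism onto
`h(λ, μ, φ)` (`IsAdaptedFrame.toModel_lie`), and the orthogonal complement of the frame is
central.
-/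

/-! ### Invariant metrics -/

namespace IsInvariantMetric

variable {F g : Type*} [Field F] [LieRing g] [LieAlgebra F g] {B : LinearMap.BilinForm F g}

theorem comm (hB : IsInvariantMetric B) (x y : g) : B x y = B y x := hB.symm.eq x y

theorem eq_zero (hB : IsInvariantMetric B) {x : g} (h : ∀ y, B x y = 0) : x = 0 :=
  hB.nondegenerate.1 x h

theorem lie_right (hB : IsInvariantMetric B) (x y z : g) : B x ⁅y, z⁆ = B ⁅x, y⁆ z :=
  (hB.invariant x y z).symm

theorem apply_lie_self_left (hB : IsInvariantMetric B) (x y : g) : B x ⁅x, y⁆ = 0 := by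
  rw [hB.lie_right, lie_self, map_zero, LinearMap.zero_apply]

theorem apply_lie_self_right (hB : IsInvariantMetric B) (x y : g) : B x ⁅y, x⁆ = 0 := by
  rw [← lie_skew, map_neg, hB.apply_lie_self_left, neg_zero]

end IsInvariantMetric

/-! ### The canonical ideals of a quadratic Lie algebra -/

section Canonical

variable {F g : Type*} [Field F] [LieRing g] [LieAlgebra F g] {B : LinearMap.BilinForm F g}

theorem lie_mem_descendingCentral {k : ℕ} (x : g) {y : g} (hy : y ∈ descendingCentral F g k) :
    ⁅x, y⁆ ∈ descendingCentral F g (k + 1) := by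
  rw [descendingCentral, LieModule.lowerCentralSeries_succ]
  exact LieSubmodule.lie_mem_lie (LieSubmodule.mem_top x) hy

theorem mem_ascendingCentral_succ {k : ℕ} {x : g} :
    x ∈ ascendingCentral F g (k + 1) ↔ ∀ y : g, ⁅y, x⁆ ∈ ascendingCentral F g k := by
  rw [ascendingCentral, LieSubmodule.ucs_succ, LieSubmodule.mem_normalizer]

theorem mem_ascendingCentral_one {x : g} :
    x ∈ ascendingCentral F g 1 ↔ ∀ y : g, ⁅y, x⁆ = 0 := by
  rw [mem_ascendingCentral_succ]
  simp [ascendingCentral]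

theorem ascendingCentral_mono : Monotone (ascendingCentral F g) :=
  monotone_nat_of_le_succ fun k => by
    rw [ascendingCentral, ascendingCentral, LieSubmodule.ucs_succ]
    exact LieSubmodule.le_normalizer _

theorem descendingCentral_anti : Antitone (descendingCentral F g) :=
  LieModule.antitone_lowerCentralSeries F g g

/-- A linear functional vanishing on all `[y, z]` with `z ∈ g^k` vanishes on `g^(k+1)`. -/
theorem apply_eq_zero_of_mem_descendingCentral_succ (f : g →ₗ[F] F) {k : ℕ}
    (h : ∀ y : g, ∀ z ∈ descendingCentral F g k, f ⁅y, z⁆ = 0) {x : g}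
    (hx : x ∈ descendingCentral F g (k + 1)) : f x = 0 := by
  have hx' : x ∈ (descendingCentral F g (k + 1)).toSubmodule := hx
  rw [descendingCentral, LieModule.lowerCentralSeries_succ,
    LieSubmodule.lieIdeal_oper_eq_linear_span'] at hx'
  have hle : Submodule.span F {x : g | ∃ y ∈ (⊤ : LieIdeal F g),
      ∃ n ∈ LieModule.lowerCentralSeries F g g k, ⁅y, n⁆ = x} ≤ LinearMap.ker f := by
    rw [Submodule.span_le]
    rintro _ ⟨y, -, z, hz, rfl⟩
    exact h y z hz
  exact hle hx'

/-- The terms of the two central series are orthogonal to each other: `C_k = (g^k)^⊥`. -/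
theorem mem_ascendingCentral_iff (hB : IsInvariantMetric B) (k : ℕ) (x : g) :
    x ∈ ascendingCentral F g k ↔ ∀ y ∈ descendingCentral F g k, B y x = 0 := by
  induction k generalizing x with
  | zero =>
    refine ⟨fun h y _ => ?_, fun h => ?_⟩
    · have : x = 0 := by simpa [ascendingCentral] using h
      rw [this, map_zero]
    · have : x = 0 := hB.eq_zero fun y => by
        rw [hB.comm]; exact h y (by simp [descendingCentral])
      rw [this]; exact zero_mem _
  | succ k ih =>
    rw [mem_ascendingCentral_succ]
    have key : ∀ y z : g, B z ⁅y, x⁆ = - B ⁅y, z⁆ x := fun y z => by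
      rw [hB.lie_right, ← lie_skew, map_neg, LinearMap.neg_apply]
    refine ⟨fun h z hz => ?_, fun h y => (ih _).2 fun z hz => ?_⟩
    · refine apply_eq_zero_of_mem_descendingCentral_succ (B.flip x) (fun y z hz => ?_) hz
      have := (ih _).1 (h y) z hz
      rwa [key, neg_eq_zero] at this
    · rw [key, neg_eq_zero]
      exact h _ (lie_mem_descendingCentral y hz)

theorem ascendingCentral_toSubmodule (hB : IsInvariantMetric B) (k : ℕ) :
    (ascendingCentral F g k).toSubmodule
      = B.orthogonal (descendingCentral F g k).toSubmodule := by
  ext x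
  exact mem_ascendingCentral_iff hB k x

theorem descendingCentral_toSubmodule [FiniteDimensional F g] (hB : IsInvariantMetric B) (k : ℕ) :
    (descendingCentral F g k).toSubmodule
      = B.orthogonal (ascendingCentral F g k).toSubmodule := by
  rw [ascendingCentral_toSubmodule hB,
    LinearMap.BilinForm.orthogonal_orthogonal hB.nondegenerate hB.symm.isRefl]

/-- The stable term `R` of the descending central series satisfies `R = [g, R]`; since it is
Abelian, invariance gives `R ⊆ R^⊥`, so `R` lies in a term of the ascending central series and
is therefore killed by repeated bracketing. -/
theorem exists_descendingCentral_eq_bot [FiniteDimensional F g] (hB : IsInvariantMetric B)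
    (habel : ∃ l : ℕ, IsLieAbelian (descendingCentral F g l)) :
    ∃ N : ℕ, descendingCentral F g N = ⊥ := by
  obtain ⟨l, hl⟩ := habel
  obtain ⟨M, hM⟩ := Filter.eventually_atTop.1
    (LieModule.eventually_iInf_lowerCentralSeries_eq F g g)
  have hstab : ∀ k, max l M ≤ k → descendingCentral F g k = descendingCentral F g (max l M) :=
    fun k hk => (hM k ((le_max_right _ _).trans hk)).symm.trans (hM _ (le_max_right _ _))
  set N := max l M with hN
  have hcomm : ∀ x ∈ descendingCentral F g N, ∀ y ∈ descendingCentral F g N, ⁅x, y⁆ = 0 := by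
    intro x hx y hy
    have hx' := descendingCentral_anti (le_max_left l M) hx
    have hy' := descendingCentral_anti (le_max_left l M) hy
    have := hl.trivial ⟨x, hx'⟩ ⟨y, hy'⟩
    exact congrArg Subtype.val this
  have hle : descendingCentral F g N ≤ ascendingCentral F g N := by
    intro x hx
    rw [mem_ascendingCentral_iff hB]
    intro y hy
    rw [← hstab (N + 1) (Nat.le_succ N)] at hy
    refine apply_eq_zero_of_mem_descendingCentral_succ (B.flip x) (fun a z hz => ?_) hy
    change B ⁅a, z⁆ x = 0
    rw [hB.invariant, hcomm z hz x hx, map_zero]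
  refine ⟨N + N, ?_⟩
  have h2 : ∀ k, k ≤ N → descendingCentral F g (N + k) ≤ ascendingCentral F g (N - k) := by
    intro k
    induction k with
    | zero => intro _; exact hle
    | succ k ih =>
      intro hk
      have ih' := ih (Nat.le_of_succ_le hk)
      rw [← Nat.add_assoc, descendingCentral, LieModule.lowerCentralSeries_succ,
        LieSubmodule.lieIdeal_oper_eq_span, LieSubmodule.lieSpan_le]
      rintro _ ⟨y, z, rfl⟩
      have hz := ih' z.2
      rw [show N - k = N - (k + 1) + 1 by omega, mem_ascendingCentral_succ] at hz
      exact hz y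
  have h3 := h2 N le_rfl
  rw [Nat.sub_self] at h3
  exact le_bot_iff.1 h3

theorem canonicalI_le_canonicalJ : canonicalI F g ≤ canonicalJ F g := by
  refine iSup_le fun k => le_iInf fun l => ?_
  rcases le_total k l with h | h
  · exact inf_le_left.trans ((ascendingCentral_mono (Nat.succ_le_succ h)).trans le_sup_left)
  · exact inf_le_right.trans ((descendingCentral_anti (Nat.succ_le_succ h)).trans le_sup_right)

/-- `j(g) = i(g)^⊥`. -/
theorem canonicalJ_toSubmodule [FiniteDimensional F g]
    (hB : IsInvariantMetric B) :
    (canonicalJ F g).toSubmodule = B.orthogonal (canonicalI F g).toSubmodule := by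
  have hrefl := hB.symm.isRefl
  have hsup : ∀ k, (ascendingCentral F g k).toSubmodule ⊔ (descendingCentral F g k).toSubmodule
      = B.orthogonal ((ascendingCentral F g k).toSubmodule ⊓
        (descendingCentral F g k).toSubmodule) := by
    intro k
    rw [← LinearMap.BilinForm.orthogonal_orthogonal hB.nondegenerate hrefl
      ((ascendingCentral F g k).toSubmodule ⊔ (descendingCentral F g k).toSubmodule)]
    congr 1
    ext x
    have e1 : x ∈ (ascendingCentral F g k).toSubmodule ↔
        ∀ y ∈ (descendingCentral F g k).toSubmodule, B y x = 0 := by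
      rw [ascendingCentral_toSubmodule hB]; rfl
    have e2 : x ∈ (descendingCentral F g k).toSubmodule ↔
        ∀ y ∈ (ascendingCentral F g k).toSubmodule, B y x = 0 := by
      rw [descendingCentral_toSubmodule hB]; rfl
    rw [Submodule.mem_inf, e1, e2, LinearMap.BilinForm.mem_orthogonal_iff]
    refine ⟨fun h => ⟨fun y hy => h y (Submodule.mem_sup_right hy),
      fun y hy => h y (Submodule.mem_sup_left hy)⟩, fun h y hy => ?_⟩
    obtain ⟨a, ha, b, hb, rfl⟩ := Submodule.mem_sup.1 hy
    rw [map_add, LinearMap.add_apply, h.2 a ha, h.1 b hb, add_zero]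
  ext x
  simp only [canonicalJ, canonicalI, LieSubmodule.iInf_toSubmodule, LieSubmodule.iSup_toSubmodule,
    LieSubmodule.sup_toSubmodule, LieSubmodule.inf_toSubmodule, hsup, Submodule.mem_iInf]
  constructor
  · intro h y hy
    have hle : (⨆ k, (ascendingCentral F g (k + 1)).toSubmodule ⊓
        (descendingCentral F g (k + 1)).toSubmodule) ≤ LinearMap.ker (B.flip x) :=
      iSup_le fun k y hy => h k y hy
    exact hle hy
  · intro h k y hy
    exact h y (Submodule.mem_iSup_of_mem k hy)

theorem mem_canonicalI_of_mem {k : ℕ} {x : g} (h₁ : x ∈ ascendingCentral F g (k + 1))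
    (h₂ : x ∈ descendingCentral F g (k + 1)) : x ∈ canonicalI F g :=
  LieSubmodule.mem_iSup_of_mem k ((LieSubmodule.mem_inf _ _ _).2 ⟨h₁, h₂⟩)

/-- Write `x = c_k + d_k` with `c_k ∈ C_k` and `d_k ∈ g^k`.  Modulo `i(g)` the bracket
`[y, d_k]` does not depend on `k`, since `d_k - d_(k+1) = c_(k+1) - c_k` lies in
`C_(k+1) ∩ g^k`; it is `[y, x]` for `k = 1` and `0` for large `k`. -/
theorem lie_mem_canonicalI (hnil : ∃ N : ℕ, descendingCentral F g N = ⊥) (y : g) {x : g}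
    (hx : x ∈ canonicalJ F g) : ⁅y, x⁆ ∈ canonicalI F g := by
  have hdec : ∀ k, ∃ c ∈ ascendingCentral F g (k + 1), ∃ d ∈ descendingCentral F g (k + 1),
      c + d = x := fun k => (LieSubmodule.mem_sup _ _ _).1 ((LieSubmodule.mem_iInf _).1 hx k)
  choose c hc d hd hcd using hdec
  have key : ∀ k, ⁅y, x⁆ - ⁅y, d k⁆ ∈ canonicalI F g := by
    intro k
    induction k with
    | zero =>
      have : ⁅y, x⁆ - ⁅y, d 0⁆ = 0 := by
        rw [← lie_sub, ← hcd 0, add_sub_cancel_right]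
        exact mem_ascendingCentral_one.1 (hc 0) y
      rw [this]; exact zero_mem _
    | succ k ih =>
      have hsub : d k - d (k + 1) = c (k + 1) - c k := by
        rw [sub_eq_sub_iff_add_eq_add, add_comm, hcd, hcd]
      have h1 : d k - d (k + 1) ∈ ascendingCentral F g (k + 1 + 1) := by
        rw [hsub]
        exact sub_mem (hc _) (ascendingCentral_mono (Nat.le_succ _) (hc k))
      have h2 : d k - d (k + 1) ∈ descendingCentral F g (k + 1) :=
        sub_mem (hd k) (descendingCentral_anti (Nat.le_succ _) (hd _))
      have h3 : ⁅y, d k - d (k + 1)⁆ ∈ canonicalI F g :=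
        mem_canonicalI_of_mem (mem_ascendingCentral_succ.1 h1 y)
          (descendingCentral_anti (Nat.le_succ _) (lie_mem_descendingCentral y h2))
      have h4 := add_mem ih h3
      rwa [lie_sub, sub_add_sub_cancel] at h4
  obtain ⟨N, hN⟩ := hnil
  have h0 : d N = 0 := by
    have := descendingCentral_anti (Nat.le_succ N) (hd N)
    rwa [hN, LieSubmodule.mem_bot] at this
  have := key N
  rwa [h0, lie_zero, sub_zero] at this

theorem canonicalI_le_descendingCentral_one : canonicalI F g ≤ descendingCentral F g 1 :=
  iSup_le fun k => inf_le_right.trans (descendingCentral_anti (Nat.le_add_left 1 k))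

end Canonical

/-! ### Coframes of Heisenberg type -/

/-- Vectors `t 0, t 1, t 2` whose associated functionals `B(t k, ·)` are the three coordinates
of a surjective homomorphism from `g` onto the Heisenberg algebra (`lie_zero`, `lie_one`,
`lie_two` express multiplicativity through invariance), where the common kernel of these
functionals has the properties of `j(g)`: it contains the vectors `t k` and the centre, it is
Abelian, and it is orthogonal to every central element of `[g, g]`. -/
structure IsHeisenbergCoframe {F g : Type*} [Field F] [LieRing g] [LieAlgebra F g]
    (B : LinearMap.BilinForm F g) (t : Fin 3 → g) : Prop where
  lie_zero : ∀ x : g, ⁅x, t 0⁆ = 0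
  lie_one : ∀ x : g, ⁅x, t 1⁆ = 0
  lie_two : ∀ x : g, ⁅x, t 2⁆ = B (t 1) x • t 0 - B (t 0) x • t 1
  exists_lift : ∀ a : Fin 3 → F, ∃ x, ∀ k, B (t k) x = a k
  isotropic : ∀ k l, B (t k) (t l) = 0
  abelian : ∀ x y : g, (∀ k, B (t k) x = 0) → (∀ k, B (t k) y = 0) → ⁅x, y⁆ = 0
  center : ∀ z : g, (∀ x : g, ⁅x, z⁆ = 0) → ∀ k, B (t k) z = 0
  center_derived : ∀ z : g, (∀ x : g, ⁅x, z⁆ = 0) → z ∈ descendingCentral F g 1 →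
    ∀ y, (∀ k, B (t k) y = 0) → B z y = 0

section

variable {F g : Type*} [Field F] [LieRing g] [LieAlgebra F g] [FiniteDimensional F g]
  {B : LinearMap.BilinForm F g}

theorem mem_canonicalJ_iff (hB : IsInvariantMetric B) {x : g} :
    x ∈ canonicalJ F g ↔ ∀ y ∈ canonicalI F g, B y x = 0 := by
  rw [← LieSubmodule.mem_toSubmodule, canonicalJ_toSubmodule hB]
  rfl

theorem mem_canonicalI_iff (hB : IsInvariantMetric B) {x : g} :
    x ∈ canonicalI F g ↔ ∀ y ∈ canonicalJ F g, B y x = 0 := by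
  rw [← LieSubmodule.mem_toSubmodule, ← LinearMap.BilinForm.orthogonal_orthogonal
    hB.nondegenerate hB.symm.isRefl (canonicalI F g).toSubmodule, ← canonicalJ_toSubmodule hB]
  rfl

/-- The elements of `i(g)` representing the coordinates of `g / j(g) ≅ h` through the metric form a
coframe. -/
theorem exists_isHeisenbergCoframe (hB : IsInvariantMetric B)
    (habel : ∃ l : ℕ, IsLieAbelian (descendingCentral F g l))
    (f : (g ⧸ canonicalJ F g) ≃ₗ⁅F⁆ Heisenberg F) :
    ∃ t : Fin 3 → g, IsHeisenbergCoframe B t := by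
  have hnil := exists_descendingCentral_eq_bot hB habel
  let π : g →ₗ[F] Heisenberg F := f.toLinearEquiv.toLinearMap ∘ₗ
    (LieSubmodule.Quotient.mk' (canonicalJ F g)).toLinearMap
  have hπ_lie : ∀ x y, π ⁅x, y⁆ = ⁅π x, π y⁆ := fun x y =>
    f.map_lie (LieSubmodule.Quotient.mk x) (LieSubmodule.Quotient.mk y)
  have hπ_ker : ∀ x, π x = 0 ↔ x ∈ canonicalJ F g := fun x => by
    rw [← LieSubmodule.Quotient.mk_eq_zero']
    exact ⟨fun h => f.injective (h.trans f.map_zero.symm),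
      fun h => (congrArg f h).trans f.map_zero⟩
  have hπ_surj : ∀ a : Heisenberg F, ∃ x, π x = a := fun a => by
    obtain ⟨q, rfl⟩ := f.surjective a
    obtain ⟨x, rfl⟩ := LieSubmodule.Quotient.surjective_mk' _ q
    exact ⟨x, rfl⟩
  let c : Fin 3 → Dual F g := fun k =>
    { toFun := fun x => π x k
      map_add' := fun x y => by rw [map_add, Heisenberg.add_apply]
      map_smul' := fun a x => by rw [map_smul, Heisenberg.smul_apply]; rfl }
  let t : Fin 3 → g := fun k => (B.toDual hB.nondegenerate).symm (c k)
  have ht : ∀ k x, B (t k) x = π x k := fun k x =>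
    LinearMap.BilinForm.apply_toDual_symm_apply (c k) x
  have hJ : ∀ x, (∀ k, B (t k) x = 0) ↔ x ∈ canonicalJ F g := fun x => by
    rw [← hπ_ker, Heisenberg.ext_iff]
    simp only [ht, Heisenberg.zero_apply]
  have htI : ∀ k, t k ∈ canonicalI F g := fun k => (mem_canonicalI_iff hB).2 fun y hy => by
    rw [hB.comm]; exact (hJ y).2 hy k
  have hlie : ∀ x y k, B (t k) ⁅x, y⁆ = if k = 2 then π x 0 * π y 1 - π x 1 * π y 0 else 0 :=
    fun x y k => by rw [ht, hπ_lie, Heisenberg.bracket_apply]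
  refine ⟨t, fun x => hB.eq_zero fun y => ?_, fun x => hB.eq_zero fun y => ?_,
    fun x => ?_, fun a => ?_, fun k l => ?_, fun x y hx hy => ?_, fun z hz k => ?_,
    fun z hz hz' y hy => ?_⟩
  · rw [← lie_skew, map_neg, LinearMap.neg_apply, hB.invariant, hlie]; simp
  · rw [← lie_skew, map_neg, LinearMap.neg_apply, hB.invariant, hlie]; simp
  · rw [← sub_eq_zero]
    refine hB.eq_zero fun y => ?_
    rw [← lie_skew]
    simp only [map_sub, map_neg, map_smul, LinearMap.sub_apply, LinearMap.neg_apply,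
      LinearMap.smul_apply, hB.invariant, hlie, ht, smul_eq_mul, if_true]
    ring
  · obtain ⟨x, hx⟩ := hπ_surj a
    exact ⟨x, fun k => by rw [ht, hx]⟩
  · exact (mem_canonicalJ_iff hB).1 (canonicalI_le_canonicalJ (htI l)) _ (htI k)
  · rw [hJ] at hx hy
    refine hB.eq_zero fun z => ?_
    rw [hB.invariant, hB.comm, ← lie_skew, map_neg, LinearMap.neg_apply, neg_eq_zero]
    exact (mem_canonicalJ_iff hB).1 hx _ (lie_mem_canonicalI hnil z hy)
  · have h1 := (mem_ascendingCentral_iff hB 1 z).1 (mem_ascendingCentral_one.2 hz)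
    exact h1 _ (canonicalI_le_descendingCentral_one (htI k))
  · rw [hB.comm]
    exact (mem_canonicalI_iff hB).1
      (mem_canonicalI_of_mem (k := 0) (mem_ascendingCentral_one.2 hz) hz') y ((hJ y).1 hy)

/-- `i(g)` and `g / j(g)` are in duality, so both have dimension three. -/
theorem finrank_eq_add_six (hB : IsInvariantMetric B)
    (f : (g ⧸ canonicalJ F g) ≃ₗ⁅F⁆ Heisenberg F) :
    finrank F g = finrank F ((canonicalJ F g).toSubmodule ⧸
      (canonicalI F g).toSubmodule.submoduleOf (canonicalJ F g).toSubmodule) + 6 := by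
  have h1 : finrank F (g ⧸ (canonicalJ F g).toSubmodule) = 3 := by
    have e := f.toLinearEquiv.finrank_eq
    have e' : finrank F (Heisenberg F) = finrank F (Fin 3 → F) := rfl
    rw [e', finrank_fin_fun] at e
    exact e
  have h2 := Submodule.finrank_quotient_add_finrank (canonicalJ F g).toSubmodule
  have h3 := Submodule.finrank_quotient_add_finrank
    ((canonicalI F g).toSubmodule.submoduleOf (canonicalJ F g).toSubmodule)
  have h4 := (Submodule.submoduleOfEquivOfLe (p := (canonicalI F g).toSubmodule)
    (q := (canonicalJ F g).toSubmodule) canonicalI_le_canonicalJ).finrank_eq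
  have h5 := LinearMap.BilinForm.finrank_orthogonal hB.nondegenerate (canonicalI F g).toSubmodule
  rw [← canonicalJ_toSubmodule hB] at h5
  have h6 := Submodule.finrank_le (canonicalI F g).toSubmodule
  omega

end

/-- The images of `p₀` and `p₁` under the homomorphism onto the Heisenberg algebra with coordinates
`B(t k, ·)` are its first two basis vectors. -/
structure IsLift {F g : Type*} [Field F] [LieRing g] [LieAlgebra F g]
    (B : LinearMap.BilinForm F g) (t : Fin 3 → g) (p₀ p₁ : g) : Prop where
  zero_left : B (t 0) p₀ = 1
  one_left : B (t 1) p₀ = 0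
  two_left : B (t 2) p₀ = 0
  zero_right : B (t 0) p₁ = 0
  one_right : B (t 1) p₁ = 1
  two_right : B (t 2) p₁ = 0

namespace IsHeisenbergCoframe

variable {F g : Type*} [Field F] [LieRing g] [LieAlgebra F g]
  {B : LinearMap.BilinForm F g} {t : Fin 3 → g} {p₀ p₁ : g}

theorem apply_zero_lie (hB : IsInvariantMetric B) (ht : IsHeisenbergCoframe B t) (x y : g) :
    B (t 0) ⁅x, y⁆ = 0 := by
  rw [hB.lie_right, ← lie_skew, ht.lie_zero]; simp

theorem apply_one_lie (hB : IsInvariantMetric B) (ht : IsHeisenbergCoframe B t) (x y : g) :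
    B (t 1) ⁅x, y⁆ = 0 := by
  rw [hB.lie_right, ← lie_skew, ht.lie_one]; simp

theorem apply_two_lie (hB : IsInvariantMetric B) (ht : IsHeisenbergCoframe B t) (x y : g) :
    B (t 2) ⁅x, y⁆ = B (t 0) x * B (t 1) y - B (t 1) x * B (t 0) y := by
  rw [hB.lie_right, ← lie_skew, ht.lie_two]; simp

theorem apply_lie_eq_zero (hB : IsInvariantMetric B) (ht : IsHeisenbergCoframe B t) (x : g) {y : g}
    (h₀ : B (t 0) y = 0) (h₁ : B (t 1) y = 0) (k : Fin 3) : B (t k) ⁅x, y⁆ = 0 := by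
  fin_cases k
  · exact ht.apply_zero_lie hB x y
  · exact ht.apply_one_lie hB x y
  · refine (ht.apply_two_lie hB x y).trans ?_
    rw [h₀, h₁]; ring

theorem apply_lie_lie (hB : IsInvariantMetric B) (ht : IsHeisenbergCoframe B t) (x y z : g)
    (k : Fin 3) : B (t k) ⁅x, ⁅y, z⁆⁆ = 0 :=
  ht.apply_lie_eq_zero hB x (ht.apply_zero_lie hB y z) (ht.apply_one_lie hB y z) k

/-- Brackets with elements of the common kernel of the functionals `B(t k, ·)` are orthogonal
to that kernel, which is Abelian. -/
theorem apply_lie_of_ker (hB : IsInvariantMetric B) (ht : IsHeisenbergCoframe B t) {v z : g} (y : g)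
    (hv : ∀ k, B (t k) v = 0) (hz : ∀ k, B (t k) z = 0) : B ⁅y, v⁆ z = 0 := by
  rw [hB.invariant, ht.abelian v z hv hz, map_zero]

theorem apply_lie_of_ker' (hB : IsInvariantMetric B) (ht : IsHeisenbergCoframe B t) {v z : g} (y : g)
    (hv : ∀ k, B (t k) v = 0) (hz : ∀ k, B (t k) z = 0) : B ⁅v, y⁆ z = 0 := by
  rw [← lie_skew, map_neg, LinearMap.neg_apply, ht.apply_lie_of_ker hB y hv hz, neg_zero]

theorem exists_isLift (ht : IsHeisenbergCoframe B t) : ∃ p₀ p₁, IsLift B t p₀ p₁ := by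
  obtain ⟨p, hp⟩ := ht.exists_lift ![1, 0, 0]
  obtain ⟨q, hq⟩ := ht.exists_lift ![0, 1, 0]
  exact ⟨p, q, by simp [hp], by simp [hp], by simp [hp], by simp [hq], by simp [hq], by simp [hq]⟩

theorem apply_two_lie_lift (hB : IsInvariantMetric B) (ht : IsHeisenbergCoframe B t)
    (hp : IsLift B t p₀ p₁) : B (t 2) ⁅p₀, p₁⁆ = 1 := by
  rw [ht.apply_two_lie hB, hp.zero_left, hp.one_left, hp.zero_right, hp.one_right]; ring

/-- The decomposition of an element along lifts of the basis of the Heisenberg algebra. -/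
theorem exists_decomposition (hB : IsInvariantMetric B) (ht : IsHeisenbergCoframe B t)
    (hp : IsLift B t p₀ p₁) (x : g) : ∃ x', (∀ k, B (t k) x' = 0) ∧
      x = B (t 0) x • p₀ + B (t 1) x • p₁ + B (t 2) x • ⁅p₀, p₁⁆ + x' := by
  refine ⟨x - (B (t 0) x • p₀ + B (t 1) x • p₁ + B (t 2) x • ⁅p₀, p₁⁆), fun k => ?_, by abel⟩
  fin_cases k <;>
  simp [hp.zero_left, hp.one_left, hp.zero_right, hp.one_right, hp.two_left, hp.two_right,
    ht.apply_zero_lie hB, ht.apply_one_lie hB, ht.apply_two_lie_lift hB hp]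

theorem eq_zero_of_apply (hB : IsInvariantMetric B) (ht : IsHeisenbergCoframe B t)
    (hp : IsLift B t p₀ p₁) {u : g} (h₀ : B u p₀ = 0) (h₁ : B u p₁ = 0) (h₂ : B u ⁅p₀, p₁⁆ = 0)
    (hu : ∀ z, (∀ k, B (t k) z = 0) → B u z = 0) : u = 0 := by
  refine hB.eq_zero fun y => ?_
  obtain ⟨y', hy', e⟩ := ht.exists_decomposition hB hp y
  rw [e]
  simp [h₀, h₁, h₂, hu y' hy']

/-- An element of the common kernel of the functionals `B(t k, ·)` is central if it is orthogonal to
`q = [p₀, p₁]`, `[p₀, q]` and `[p₁, q]`, which span `[g, g]` up to `span t`. -/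
theorem center_of_apply (hB : IsInvariantMetric B) (ht : IsHeisenbergCoframe B t)
    (hp : IsLift B t p₀ p₁) {u : g} (hu : ∀ k, B (t k) u = 0) (h₂ : B u ⁅p₀, p₁⁆ = 0)
    (h₀ : B u ⁅p₀, ⁅p₀, p₁⁆⁆ = 0) (h₁ : B u ⁅p₁, ⁅p₀, p₁⁆⁆ = 0) (x : g) : ⁅x, u⁆ = 0 := by
  refine hB.eq_zero fun y => ?_
  rw [← lie_skew, map_neg, LinearMap.neg_apply, hB.invariant, neg_eq_zero]
  obtain ⟨x', hx', ex⟩ := ht.exists_decomposition hB hp x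
  obtain ⟨y', hy', ey⟩ := ht.exists_decomposition hB hp y
  have a1 : ∀ z, B u ⁅x', z⁆ = 0 := fun z => by
    rw [hB.comm]; exact ht.apply_lie_of_ker' hB z hx' hu
  have a2 : ∀ z, B u ⁅z, y'⁆ = 0 := fun z => by
    rw [hB.comm]; exact ht.apply_lie_of_ker hB z hy' hu
  have b2 : B u ⁅p₁, p₀⁆ = 0 := by rw [← lie_skew, map_neg, h₂, neg_zero]
  have b0 : B u ⁅⁅p₀, p₁⁆, p₀⁆ = 0 := by rw [← lie_skew, map_neg, h₀, neg_zero]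
  have b1 : B u ⁅⁅p₀, p₁⁆, p₁⁆ = 0 := by rw [← lie_skew, map_neg, h₁, neg_zero]
  rw [ex, ey]
  simp only [add_lie, lie_add, smul_lie, lie_smul, map_add, map_smul, a1, a2, b0, b1, b2, h₀, h₁,
    h₂, lie_self, map_zero, smul_zero, add_zero]

/-- Up to `span t`, the bracket `[w, q]` is central as soon as it is orthogonal to `[p₀, q]` and
`[p₁, q]`, where `q = [p₀, p₁]`.  Being a central element of `[g, g]`, it is then orthogonal to
the common kernel of the functionals `B(t k, ·)`. -/
theorem apply_lie_eq_zero_of_gram (hB : IsInvariantMetric B) (ht : IsHeisenbergCoframe B t)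
    (hp : IsLift B t p₀ p₁) (w : g) (h₀ : B ⁅w, ⁅p₀, p₁⁆⁆ ⁅p₀, ⁅p₀, p₁⁆⁆ = 0)
    (h₁ : B ⁅w, ⁅p₀, p₁⁆⁆ ⁅p₁, ⁅p₀, p₁⁆⁆ = 0) (z : g) (hz : ∀ k, B (t k) z = 0) :
    B ⁅w, ⁅p₀, p₁⁆⁆ z = 0 := by
  set q := ⁅p₀, p₁⁆ with hq
  -- correct the bracket by central elements so that it is orthogonal to the lifts and to `q`
  set u := ⁅w, q⁆ - B ⁅w, q⁆ p₀ • t 0 - B ⁅w, q⁆ p₁ • t 1 with hu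
  have hq0 : B (t 0) q = 0 := ht.apply_zero_lie hB _ _
  have hq1 : B (t 1) q = 0 := ht.apply_one_lie hB _ _
  have huq : B ⁅w, q⁆ q = 0 := by rw [hB.invariant, lie_self, map_zero]
  have hut : ∀ k, B (t k) u = 0 := fun k => by
    simp [hu, ht.apply_lie_lie hB w p₀ p₁ k, ht.isotropic, hq]
  have hcen : ∀ x : g, ⁅x, u⁆ = 0 := by
    refine ht.center_of_apply hB hp hut ?_ ?_ ?_
    · simp [hu, ← hq, huq, hq0, hq1]
    · simp [hu, ← hq, h₀, ht.apply_zero_lie hB, ht.apply_one_lie hB]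
    · simp [hu, ← hq, h₁, ht.apply_zero_lie hB, ht.apply_one_lie hB]
  have ht0 : t 0 = ⁅p₁, t 2⁆ := by rw [ht.lie_two, hp.one_right, hp.zero_right]; simp
  have ht1 : t 1 = ⁅t 2, p₀⁆ := by
    rw [← lie_skew, ht.lie_two, hp.one_left, hp.zero_left]; simp
  have hmem : ∀ x y : g, ⁅x, y⁆ ∈ descendingCentral F g 1 := fun x y =>
    lie_mem_descendingCentral x (by simp [descendingCentral])
  have hder : u ∈ descendingCentral F g 1 := by
    refine sub_mem (sub_mem (hmem _ _) (Submodule.smul_mem _ _ ?_))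
      (Submodule.smul_mem _ _ ?_)
    · rw [ht0]; exact hmem _ _
    · rw [ht1]; exact hmem _ _
  have := ht.center_derived u hcen hder z hz
  simpa [hu, hz] using this

/-- If `[p₀, q]` and `[p₁, q]`, with `q = [p₀, p₁]`, were both orthogonal to the common kernel of
the functionals `B(t k, ·)`, then `q - B(q, q) • t 2` would be central, although
`B(t 2, q) = 1`. -/
theorem not_forall_apply_lie_eq_zero (hB : IsInvariantMetric B) (ht : IsHeisenbergCoframe B t)
    (hp : IsLift B t p₀ p₁)
    (h₀ : ∀ z, (∀ k, B (t k) z = 0) → B ⁅p₀, ⁅p₀, p₁⁆⁆ z = 0)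
    (h₁ : ∀ z, (∀ k, B (t k) z = 0) → B ⁅p₁, ⁅p₀, p₁⁆⁆ z = 0) : False := by
  set q := ⁅p₀, p₁⁆ with hq
  have hq0 : B (t 0) q = 0 := ht.apply_zero_lie hB _ _
  have hq1 : B (t 1) q = 0 := ht.apply_one_lie hB _ _
  have hq2 : B (t 2) q = 1 := ht.apply_two_lie_lift hB hp
  have e0 : ⁅p₀, q⁆ + B q q • t 1 = 0 := by
    refine ht.eq_zero_of_apply hB hp ?_ ?_ ?_ fun z hz => ?_
    · simp [hp.one_left, hB.invariant, hB.apply_lie_self_right]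
    · simp only [map_add, map_smul, LinearMap.add_apply, LinearMap.smul_apply, hp.one_right,
        smul_eq_mul, mul_one]
      rw [← lie_skew, map_neg, LinearMap.neg_apply, hB.invariant, ← hq]; ring
    · simp [← hq, hq1, hB.invariant]
    · simp [h₀ z hz, hz]
  have e1 : ⁅p₁, q⁆ - B q q • t 0 = 0 := by
    refine ht.eq_zero_of_apply hB hp ?_ ?_ ?_ fun z hz => ?_
    · simp only [map_sub, map_smul, LinearMap.sub_apply, LinearMap.smul_apply, hp.zero_left,
        smul_eq_mul, mul_one]
      rw [← lie_skew, map_neg, LinearMap.neg_apply, hB.invariant, ← lie_skew, map_neg, ← hq]; ring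
    · simp [hp.zero_right, hB.invariant, hB.apply_lie_self_right]
    · simp [← hq, hq0, hB.invariant]
    · simp [h₁ z hz, hz]
  have f0 : ⁅p₀, q - B q q • t 2⁆ = 0 := by
    rw [lie_sub, lie_smul, ht.lie_two, hp.one_left, hp.zero_left, ← e0]; simp
  have f1 : ⁅p₁, q - B q q • t 2⁆ = 0 := by
    rw [lie_sub, lie_smul, ht.lie_two, hp.one_right, hp.zero_right, ← e1]; simp
  have f2 : ⁅q, q - B q q • t 2⁆ = 0 := by
    rw [lie_sub, lie_smul, ht.lie_two, hq0, hq1]; simp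
  have hcen : ∀ x : g, ⁅x, q - B q q • t 2⁆ = 0 := by
    intro x
    obtain ⟨x', hx', ex⟩ := ht.exists_decomposition hB hp x
    have fx : ⁅x', q - B q q • t 2⁆ = 0 := by
      refine ht.eq_zero_of_apply hB hp ?_ ?_ ?_ fun z hz => ht.apply_lie_of_ker' hB _ hx' hz
      · rw [hB.invariant, ← lie_skew, f0]; simp
      · rw [hB.invariant, ← lie_skew, f1]; simp
      · rw [hB.invariant, ← lie_skew, ← hq, f2]; simp
    rw [ex, add_lie, add_lie, add_lie, smul_lie, smul_lie, smul_lie, f0, f1, ← hq, f2, fx]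
    simp
  have := ht.center _ hcen 2
  simp [hq2, ht.isotropic] at this

end IsHeisenbergCoframe

/-! ### Normalizing the Gram matrix and the lifts -/

/-- The symmetric `2 × 2` matrix `(a, b; b, c)` becomes `diag(m, 1)` with `m = 0` or `m = 1`
under `S ↦ det(P)² • P S Pᵀ` for a suitable invertible `P`, unless it is zero. -/
theorem exists_twisted_diagonalization {F : Type*} [Field F] [IsAlgClosed F] [CharZero F]
    (a b c : F) (h : ¬ (a = 0 ∧ b = 0 ∧ c = 0)) :
    ∃ α β γ δ : F, α * δ - β * γ ≠ 0 ∧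
      (α * δ - β * γ) ^ 2 * (γ ^ 2 * a + 2 * γ * δ * b + δ ^ 2 * c) = 1 ∧
      (α * δ - β * γ) ^ 2 * (α * γ * a + (α * δ + β * γ) * b + β * δ * c) = 0 ∧
      ((α * δ - β * γ) ^ 2 * (α ^ 2 * a + 2 * α * β * b + β ^ 2 * c) = 0 ∨
        (α * δ - β * γ) ^ 2 * (α ^ 2 * a + 2 * α * β * b + β ^ 2 * c) = 1) := by
  -- a vector `(γ, δ)` on which the quadratic form does not vanish
  obtain ⟨γ, δ, hn⟩ : ∃ γ δ : F, γ ^ 2 * a + 2 * γ * δ * b + δ ^ 2 * c ≠ 0 := by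
    by_contra! hall
    have h1 := hall 1 0
    have h2 := hall 0 1
    have h3 := hall 1 1
    simp only [one_pow, one_mul, mul_one, mul_zero, zero_mul, add_zero, zero_add, ne_eq,
      OfNat.ofNat_ne_zero, not_false_eq_true, zero_pow] at h1 h2 h3
    rw [h1, h2, zero_add, add_zero, mul_eq_zero] at h3
    exact h ⟨h1, h3.resolve_left two_ne_zero, h2⟩
  set n := γ ^ 2 * a + 2 * γ * δ * b + δ ^ 2 * c with hndef
  -- `(α, β)` is orthogonal to `(γ, δ)` for the symmetric form
  set α := -(γ * b + δ * c) with hα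
  set β := γ * a + δ * b with hβ
  set m := α ^ 2 * a + 2 * α * β * b + β ^ 2 * c with hm
  have hdet : α * δ - β * γ = -n := by rw [hα, hβ, hndef]; ring
  have horth : α * γ * a + (α * δ + β * γ) * b + β * δ * c = 0 := by rw [hα, hβ]; ring
  -- rescaling both vectors by `x` and `y` multiplies the determinant by `x * y`
  suffices H : ∃ x y : F, x ≠ 0 ∧ y ≠ 0 ∧ (x * y * n) ^ 2 * (y ^ 2 * n) = 1 ∧
      ((x * y * n) ^ 2 * (x ^ 2 * m) = 0 ∨ (x * y * n) ^ 2 * (x ^ 2 * m) = 1) by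
    obtain ⟨x, y, hx, hy, h1, h2⟩ := H
    have hD : x * α * (y * δ) - x * β * (y * γ) = - (x * y * n) := by
      linear_combination x * y * hdet
    refine ⟨x * α, x * β, y * γ, y * δ, ?_, ?_, ?_, ?_⟩
    · rw [hD]; exact neg_ne_zero.2 (mul_ne_zero (mul_ne_zero hx hy) hn)
    · rw [hD, ← h1, hndef]; ring
    · rw [hD]; linear_combination (x * y * n) ^ 2 * x * y * horth
    · rw [hD]
      refine h2.imp (fun h => ?_) (fun h => ?_) <;> rw [← h, hm] <;> ring
  by_cases hm0 : m = 0
  · obtain ⟨y, hy⟩ := IsAlgClosed.exists_pow_nat_eq ((n ^ 3)⁻¹) (n := 4) (by norm_num)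
    have hy0 : y ≠ 0 := by
      rintro rfl
      rw [zero_pow (by norm_num)] at hy
      exact inv_ne_zero (pow_ne_zero 3 hn) hy.symm
    refine ⟨1, y, one_ne_zero, hy0, ?_, Or.inl (by rw [hm0]; ring)⟩
    have : y ^ 4 * n ^ 3 = 1 := by rw [hy, inv_mul_cancel₀ (pow_ne_zero 3 hn)]
    linear_combination this
  · obtain ⟨s, hs⟩ := IsAlgClosed.exists_pow_nat_eq (m / n) (n := 2) (by norm_num)
    obtain ⟨x, hx⟩ := IsAlgClosed.exists_pow_nat_eq ((n * m ^ 2)⁻¹) (n := 6) (by norm_num)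
    have hs' : s ^ 2 * n = m := by rw [hs, div_mul_cancel₀ _ hn]
    have hx' : x ^ 6 * (n * m ^ 2) = 1 := by
      rw [hx, inv_mul_cancel₀ (mul_ne_zero hn (pow_ne_zero 2 hm0))]
    have hx0 : x ≠ 0 := by
      rintro rfl
      simp at hx'
    have hs0 : s ≠ 0 := by
      rintro rfl
      exact hm0 (by rw [← hs']; ring)
    refine ⟨x, x * s, hx0, mul_ne_zero hx0 hs0, ?_, Or.inr ?_⟩
    · rw [← hx', ← hs']; ring
    · rw [← hx', ← hs']; ring

namespace IsHeisenbergCoframe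

variable {F g : Type*} [Field F] [LieRing g] [LieAlgebra F g]
  {B : LinearMap.BilinForm F g} {t : Fin 3 → g} {p₀ p₁ : g}

/-- The coframe change dual to the automorphism of the Heisenberg algebra which is given on
`x₁, x₂` by an invertible `2 × 2` matrix. -/
theorem change (ht : IsHeisenbergCoframe B t) (a b c d : F) (hD : a * d - b * c ≠ 0) :
    IsHeisenbergCoframe B
      ![a • t 0 + b • t 1, c • t 0 + d • t 1, (a * d - b * c) • t 2] := by
  have hker : ∀ x, (∀ k, B (![a • t 0 + b • t 1, c • t 0 + d • t 1,
      (a * d - b * c) • t 2] k) x = 0) ↔ ∀ k, B (t k) x = 0 := by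
    intro x
    simp only [Fin.forall_fin_succ, Fin.isValue, Matrix.cons_val_zero, Matrix.cons_val_succ,
      map_add, map_smul, LinearMap.add_apply, LinearMap.smul_apply, smul_eq_mul,
      IsEmpty.forall_iff, and_true, Fin.succ_zero_eq_one, Fin.succ_one_eq_two]
    constructor
    · rintro ⟨h0, h1, h2⟩
      refine ⟨?_, ?_, (mul_eq_zero.1 h2).resolve_left hD⟩
      · refine (mul_eq_zero.1 ?_).resolve_left hD
        linear_combination d * h0 - b * h1
      · refine (mul_eq_zero.1 ?_).resolve_left hD
        linear_combination a * h1 - c * h0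
    · rintro ⟨h0, h1, h2⟩
      simp [h0, h1, h2]
  have htk : ∀ l k, B (t k) (![a • t 0 + b • t 1, c • t 0 + d • t 1,
      (a * d - b * c) • t 2] l) = 0 := by
    intro l k
    fin_cases l <;> simp [ht.isotropic]
  refine ⟨fun x => ?_, fun x => ?_, fun x => ?_, fun v => ?_, fun k l => (hker _).2 (htk l) k,
    fun x y hx hy => ht.abelian x y ((hker x).1 hx) ((hker y).1 hy),
    fun z hz => (hker z).2 (ht.center z hz),
    fun z hz hz' y hy => ht.center_derived z hz hz' y ((hker y).1 hy)⟩
  · simp [ht.lie_zero, ht.lie_one]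
  · simp [ht.lie_zero, ht.lie_one]
  · simp only [Matrix.cons_val, lie_smul, ht.lie_two, map_add, map_smul, LinearMap.add_apply,
      LinearMap.smul_apply, smul_eq_mul]
    module
  · obtain ⟨x, hx⟩ := ht.exists_lift ![(a * d - b * c)⁻¹ * (d * v 0 - b * v 1),
      (a * d - b * c)⁻¹ * (a * v 1 - c * v 0), (a * d - b * c)⁻¹ * v 2]
    refine ⟨x, fun k => ?_⟩
    have hi := inv_mul_cancel₀ hD
    fin_cases k <;> simp [hx]
    · linear_combination v 0 * hi
    · linear_combination v 1 * hi
    · linear_combination v 2 * hi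

/-- After a change of coframe, the Gram matrix of `[p₀, q]`, `[p₁, q]`, where `q = [p₀, p₁]`, is
`diag(0, 1)` or the identity. -/
theorem exists_normalized_gram [IsAlgClosed F] [CharZero F] (hB : IsInvariantMetric B)
    (ht : IsHeisenbergCoframe B t) :
    ∃ (t : Fin 3 → g) (p₀ p₁ : g), IsHeisenbergCoframe B t ∧ IsLift B t p₀ p₁ ∧
      B ⁅p₁, ⁅p₀, p₁⁆⁆ ⁅p₁, ⁅p₀, p₁⁆⁆ = 1 ∧ B ⁅p₀, ⁅p₀, p₁⁆⁆ ⁅p₁, ⁅p₀, p₁⁆⁆ = 0 ∧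
      (B ⁅p₀, ⁅p₀, p₁⁆⁆ ⁅p₀, ⁅p₀, p₁⁆⁆ = 0 ∨ B ⁅p₀, ⁅p₀, p₁⁆⁆ ⁅p₀, ⁅p₀, p₁⁆⁆ = 1) := by
  obtain ⟨p₀, p₁, hp⟩ := ht.exists_isLift
  have hne : ¬ (B ⁅p₀, ⁅p₀, p₁⁆⁆ ⁅p₀, ⁅p₀, p₁⁆⁆ = 0 ∧ B ⁅p₀, ⁅p₀, p₁⁆⁆ ⁅p₁, ⁅p₀, p₁⁆⁆ = 0 ∧
      B ⁅p₁, ⁅p₀, p₁⁆⁆ ⁅p₁, ⁅p₀, p₁⁆⁆ = 0) := by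
    rintro ⟨h0, h1, h2⟩
    exact ht.not_forall_apply_lie_eq_zero hB hp (ht.apply_lie_eq_zero_of_gram hB hp p₀ h0 h1)
      (ht.apply_lie_eq_zero_of_gram hB hp p₁ ((hB.comm _ _).trans h1) h2)
  obtain ⟨α, β, γ, δ, hD, h1, h2, h3⟩ := exists_twisted_diagonalization _ _ _ hne
  set D := α * δ - β * γ with hDdef
  have hlie : ⁅α • p₀ + β • p₁, γ • p₀ + δ • p₁⁆ = D • ⁅p₀, p₁⁆ := by
    simp only [add_lie, lie_add, smul_lie, lie_smul, lie_self, ← lie_skew p₁ p₀]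
    module
  have hdet : δ / D * (α / D) - -γ / D * (-β / D) ≠ 0 := by
    have : δ / D * (α / D) - -γ / D * (-β / D) = D⁻¹ := by
      field_simp
      rw [hDdef]; ring
    rw [this]; exact inv_ne_zero hD
  refine ⟨_, α • p₀ + β • p₁, γ • p₀ + δ • p₁,
    ht.change (δ / D) (-γ / D) (-β / D) (α / D) hdet, ?_, ?_, ?_, ?_⟩
  · constructor <;>
    simp [hp.zero_left, hp.one_left, hp.two_left, hp.zero_right, hp.one_right, hp.two_right] <;>
    field_simp <;> rw [hDdef] <;> ring
  · rw [hlie, ← h1]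
    simp only [lie_smul, add_lie, smul_lie, map_add, map_smul, LinearMap.add_apply,
      LinearMap.smul_apply, smul_eq_mul, hB.comm ⁅p₁, ⁅p₀, p₁⁆⁆ ⁅p₀, ⁅p₀, p₁⁆⁆]
    ring
  · rw [hlie, ← h2]
    simp only [lie_smul, add_lie, smul_lie, map_add, map_smul, LinearMap.add_apply,
      LinearMap.smul_apply, smul_eq_mul, hB.comm ⁅p₁, ⁅p₀, p₁⁆⁆ ⁅p₀, ⁅p₀, p₁⁆⁆]
    ring
  · rw [hlie]
    refine h3.imp (fun h => ?_) (fun h => ?_) <;> rw [← h] <;>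
    simp only [lie_smul, add_lie, smul_lie, map_add, map_smul, LinearMap.add_apply,
      LinearMap.smul_apply, smul_eq_mul, hB.comm ⁅p₁, ⁅p₀, p₁⁆⁆ ⁅p₀, ⁅p₀, p₁⁆⁆] <;>
    ring

/-- The Gram matrix of the brackets `[x, q]` depends only on the classes of `x` and `q` in the
Heisenberg algebra. -/
theorem gram_congr (hB : IsInvariantMetric B) (ht : IsHeisenbergCoframe B t) {x x' y y' q q' : g}
    (hx : ∀ k, B (t k) x = B (t k) x') (hy : ∀ k, B (t k) y = B (t k) y')
    (hq : ∀ k, B (t k) q = B (t k) q') (h₀ : B (t 0) q = 0) (h₁ : B (t 1) q = 0) :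
    B ⁅x, q⁆ ⁅y, q⁆ = B ⁅x', q'⁆ ⁅y', q'⁆ := by
  have hdiff : ∀ x x' : g, (∀ k, B (t k) x = B (t k) x') → ∀ z, (∀ k, B (t k) z = 0) →
      B ⁅x, q⁆ z = B ⁅x', q'⁆ z := by
    intro x x' hx z hz
    have e : ⁅x, q⁆ - ⁅x', q'⁆ = ⁅x - x', q⁆ + ⁅x', q - q'⁆ := by
      rw [sub_lie, lie_sub]; abel
    have a1 := ht.apply_lie_of_ker' hB (v := x - x') (z := z) q (fun k => by simp [hx]) hz
    have a2 := ht.apply_lie_of_ker hB (v := q - q') (z := z) x' (fun k => by simp [hq]) hz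
    rw [← sub_eq_zero, ← LinearMap.sub_apply, ← map_sub, e, map_add, LinearMap.add_apply, a1, a2,
      add_zero]
  rw [hdiff x x' hx _ (ht.apply_lie_eq_zero hB y h₀ h₁), hB.comm, hdiff y y' hy, hB.comm]
  exact ht.apply_lie_eq_zero hB x' ((hq 0).symm.trans h₀) ((hq 1).symm.trans h₁)

/-- Adding a multiple of `[p₁, q]` to `p₀` gives `B(q, q)`, where `q = [p₀, p₁]`, any prescribed
value, and adding multiples of the central elements `t 0`, `t 1` makes the lifts span an isotropic
plane.  Neither affects the Gram matrix. -/
theorem exists_isotropic_lift [CharZero F] (hB : IsInvariantMetric B)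
    (ht : IsHeisenbergCoframe B t) (hp : IsLift B t p₀ p₁)
    (h₁ : B ⁅p₁, ⁅p₀, p₁⁆⁆ ⁅p₁, ⁅p₀, p₁⁆⁆ = 1) (τ : F) :
    ∃ x₀ x₁ : g, IsLift B t x₀ x₁ ∧ B x₀ x₀ = 0 ∧ B x₀ x₁ = 0 ∧ B x₁ x₁ = 0 ∧
      B ⁅x₀, x₁⁆ ⁅x₀, x₁⁆ = τ ∧
      B ⁅x₁, ⁅x₀, x₁⁆⁆ ⁅x₁, ⁅x₀, x₁⁆⁆ = 1 ∧
      B ⁅x₀, ⁅x₀, x₁⁆⁆ ⁅x₁, ⁅x₀, x₁⁆⁆ = B ⁅p₀, ⁅p₀, p₁⁆⁆ ⁅p₁, ⁅p₀, p₁⁆⁆ ∧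
      B ⁅x₀, ⁅x₀, x₁⁆⁆ ⁅x₀, ⁅x₀, x₁⁆⁆ = B ⁅p₀, ⁅p₀, p₁⁆⁆ ⁅p₀, ⁅p₀, p₁⁆⁆ := by
  set q := ⁅p₀, p₁⁆ with hq
  set u := ⁅p₁, q⁆ with hu
  -- `B(q, [u, p₁]) = 1`, so replacing `p₀` by `p₀ + s • u` adds `2 * s` to `B(q, q)`
  set s := (τ - B q q) / 2 with hs
  have hut : ∀ k, B (t k) u = 0 := ht.apply_lie_lie hB p₁ p₀ p₁
  set w := p₀ + s • u with hw
  set x₀ := w - (B w w / 2) • t 0 with hx₀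
  set x₁ := p₁ - (B p₁ p₁ / 2) • t 1 - B x₀ p₁ • t 0 with hx₁
  have hxw : ∀ k, B (t k) x₀ = B (t k) p₀ := fun k => by
    simp [hx₀, hw, hut, ht.isotropic]
  have hxp : ∀ k, B (t k) x₁ = B (t k) p₁ := fun k => by
    simp [hx₁, ht.isotropic]
  have hx : IsLift B t x₀ x₁ :=
    ⟨(hxw 0).trans hp.zero_left, (hxw 1).trans hp.one_left, (hxw 2).trans hp.two_left,
      (hxp 0).trans hp.zero_right, (hxp 1).trans hp.one_right, (hxp 2).trans hp.two_right⟩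
  have hc0 : ∀ x : g, ⁅t 0, x⁆ = 0 := fun x => by rw [← lie_skew, ht.lie_zero, neg_zero]
  have hlie : ⁅x₀, x₁⁆ = q + s • ⁅u, p₁⁆ := by
    simp [hx₀, hx₁, hw, ht.lie_zero, ht.lie_one, hc0, hq]
  have hqk : ∀ k, B (t k) ⁅x₀, x₁⁆ = B (t k) q := fun k => by
    have h0 := ht.apply_zero_lie hB
    have h1 := ht.apply_one_lie hB
    fin_cases k
    · exact (h0 _ _).trans (h0 _ _).symm
    · exact (h1 _ _).trans (h1 _ _).symm
    · exact (ht.apply_two_lie_lift hB hx).trans (ht.apply_two_lie_lift hB hp).symm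
  have hz0 := ht.apply_zero_lie hB x₀ x₁
  have hz1 := ht.apply_one_lie hB x₀ x₁
  have hwt : B w (t 0) = 1 := by
    rw [hB.comm]; simp [hw, hut, hp.zero_left]
  have hxx : B x₀ x₀ = 0 := by
    simp only [hx₀, map_sub, map_smul, LinearMap.sub_apply, LinearMap.smul_apply, smul_eq_mul,
      hwt, hB.comm (t 0) w, ht.isotropic]
    ring
  have hxt0 : B x₀ (t 0) = 1 := (hB.comm _ _).trans hx.zero_left
  have hxt1 : B x₀ (t 1) = 0 := (hB.comm _ _).trans hx.one_left
  have hpt0 : B p₁ (t 0) = 0 := (hB.comm _ _).trans hp.zero_right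
  have hpt1 : B p₁ (t 1) = 1 := (hB.comm _ _).trans hp.one_right
  refine ⟨x₀, x₁, hx, hxx, ?_, ?_, ?_, ?_, ?_, ?_⟩
  · simp [hx₁, hxt0, hxt1]
  · simp only [hx₁, map_sub, map_smul, LinearMap.sub_apply, LinearMap.smul_apply, smul_eq_mul,
      hpt0, hpt1, hp.zero_right, hp.one_right, ht.isotropic]
    ring
  · have a1 : B ⁅u, p₁⁆ ⁅u, p₁⁆ = 0 := ht.apply_lie_of_ker' hB p₁ hut fun k => by
      rw [← lie_skew, map_neg, ht.apply_lie_eq_zero hB p₁ (hut 0) (hut 1), neg_zero]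
    have a2 : B ⁅u, p₁⁆ q = 1 := by rw [hB.invariant, ← hu, h₁]
    rw [hlie]
    simp only [map_add, map_smul, LinearMap.add_apply, LinearMap.smul_apply, smul_eq_mul, a1, a2,
      hB.comm q ⁅u, p₁⁆]
    rw [hs]; ring
  · exact (ht.gram_congr hB hxp hxp hqk hz0 hz1).trans h₁
  · exact ht.gram_congr hB hxw hxp hqk hz0 hz1
  · exact ht.gram_congr hB hxw hxw hqk hz0 hz1

end IsHeisenbergCoframe

/-! ### Orthonormal vectors in a subspace -/

section Orthonormal

variable {F g : Type*} [Field F] [AddCommGroup g] [Module F g]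
  {B : LinearMap.BilinForm F g}

theorem exists_unit_vector [IsAlgClosed F] [CharZero F] (hB : B.IsSymm) {U : Submodule F g}
    (hU : ∀ u ∈ U, (∀ u' ∈ U, B u u' = 0) → u = 0) (hdim : 0 < finrank F U) :
    ∃ u ∈ U, B u u = 1 := by
  obtain ⟨u, hu, hne⟩ : ∃ u ∈ U, B u u ≠ 0 := by
    by_contra! hall
    have hbot : U = ⊥ := by
      refine (Submodule.eq_bot_iff U).2 fun u hu => hU u hu fun u' hu' => ?_
      have h := hall (u + u') (add_mem hu hu')
      simp only [map_add, LinearMap.add_apply, hall u hu, hall u' hu', hB.eq u' u, zero_add,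
        add_zero] at h
      exact add_self_eq_zero.1 h
    rw [hbot, finrank_bot] at hdim
    exact lt_irrefl 0 hdim
  obtain ⟨c, hc⟩ := IsAlgClosed.exists_pow_nat_eq ((B u u)⁻¹) (n := 2) two_pos
  refine ⟨c • u, U.smul_mem c hu, ?_⟩
  have : c ^ 2 * B u u = 1 := by rw [hc, inv_mul_cancel₀ hne]
  simp only [map_smul, LinearMap.smul_apply, smul_eq_mul]
  linear_combination this

/-- Splitting a unit vector off a non-degenerate subspace. -/
theorem nondegenerate_inf_ker [FiniteDimensional F g] (hB : B.IsSymm) {U : Submodule F g}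
    (hU : ∀ u ∈ U, (∀ u' ∈ U, B u u' = 0) → u = 0) {w : g} (hw : w ∈ U) (hww : B w w = 1) :
    (∀ u ∈ U ⊓ LinearMap.ker (B w), (∀ u' ∈ U ⊓ LinearMap.ker (B w), B u u' = 0) → u = 0) ∧
      finrank F U ≤ finrank F ↥(U ⊓ LinearMap.ker (B w)) + 1 := by
  have hproj : ∀ u ∈ U, u - B w u • w ∈ U ⊓ LinearMap.ker (B w) := fun u hu =>
    ⟨sub_mem hu (U.smul_mem _ hw), by simp [hww]⟩
  constructor
  · rintro u ⟨hu, huw⟩ h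
    refine hU u hu fun u' hu' => ?_
    have e := h _ (hproj u' hu')
    have huw' : B w u = 0 := huw
    simpa [hB.eq u w, huw'] using e
  · have hle : U ≤ (U ⊓ LinearMap.ker (B w)) ⊔ Submodule.span F {w} := fun u hu =>
      Submodule.mem_sup.2 ⟨_, hproj u hu, B w u • w,
        Submodule.smul_mem _ _ (Submodule.mem_span_singleton_self w), by abel⟩
    have hspan : finrank F (Submodule.span F {w}) ≤ 1 := by
      have := finrank_span_le_card (R := F) ({w} : Set g)
      simpa using this
    exact (Submodule.finrank_mono hle).trans
      ((Submodule.finrank_add_le_finrank_add_finrank _ _).trans (Nat.add_le_add_left hspan _))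

/-- The orthogonal complement of the hyperbolic space spanned by the isotropic families `t`, `x`
in duality is nondegenerate, and has codimension at most six. -/
theorem exists_hyperbolic_complement [FiniteDimensional F g] (hB : B.IsSymm)
    (hnd : B.Nondegenerate) {t x : Fin 3 → g}
    (htt : ∀ k l, B (t k) (t l) = 0) (hxx : ∀ k l, B (x k) (x l) = 0)
    (htx : ∀ k l, B (t k) (x l) = if k = l then 1 else 0) :
    ∃ U : Submodule F g, (∀ u, u ∈ U ↔ (∀ k, B (t k) u = 0) ∧ ∀ k, B (x k) u = 0) ∧
      (∀ u ∈ U, (∀ u' ∈ U, B u u' = 0) → u = 0) ∧ finrank F g ≤ finrank F U + 6 := by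
  let f : g →ₗ[F] (Fin 3 → F) × (Fin 3 → F) :=
    (LinearMap.pi fun k => B (t k)).prod (LinearMap.pi fun k => B (x k))
  have hmem : ∀ u, u ∈ LinearMap.ker f ↔ (∀ k, B (t k) u = 0) ∧ ∀ k, B (x k) u = 0 := fun u => by
    simp [f, LinearMap.mem_ker, funext_iff]
  have hxt : ∀ k l, B (x k) (t l) = if k = l then 1 else 0 := fun k l => by
    rw [hB.eq, htx]; simp only [eq_comm]
  refine ⟨LinearMap.ker f, hmem, fun u hu h => ?_, ?_⟩
  · refine hnd.1 u fun z => ?_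
    have e := h (z - ∑ k, B (t k) z • x k - ∑ k, B (x k) z • t k) ((hmem _).2 ⟨fun k => by
      simp [htx, htt], fun k => by simp [hxx, hxt]⟩)
    have hu' := (hmem u).1 hu
    simpa [hB.eq u, hu'.1, hu'.2] using e
  · have h1 := LinearMap.finrank_range_add_finrank_ker f
    have h2 := Submodule.finrank_le (LinearMap.range f)
    have h3 : finrank F ((Fin 3 → F) × (Fin 3 → F)) = 6 := by simp
    omega

end Orthonormal

/-! ### Adapted frames -/

/-- A coframe `t` together with an isotropic family `x` dual to it and an orthonormal family `v`
orthogonal to both, such that `[x₀, x₁] = x₂ + ε₂ v₂`, `[x₁, x₂] = ε₀ v₀` and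
`[x₂, x₀] = ε₁ v₁`. -/
structure IsAdaptedFrame {F g : Type*} [Field F] [LieRing g] [LieAlgebra F g]
    (B : LinearMap.BilinForm F g) (ε : Fin 3 → F) (t x v : Fin 3 → g) : Prop where
  coframe : IsHeisenbergCoframe B t
  tx : ∀ k l, B (t k) (x l) = if k = l then 1 else 0
  xx : ∀ k l, B (x k) (x l) = 0
  tv : ∀ k l, B (t k) (v l) = 0
  xv : ∀ k l, B (x k) (v l) = 0
  vv : ∀ k l, B (v k) (v l) = if k = l then 1 else 0
  lie_zero_one : ⁅x 0, x 1⁆ = x 2 + ε 2 • v 2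
  lie_one_two : ⁅x 1, x 2⁆ = ε 0 • v 0
  lie_two_zero : ⁅x 2, x 0⁆ = ε 1 • v 1

namespace IsHeisenbergCoframe

variable {F g : Type*} [Field F] [IsAlgClosed F] [CharZero F] [LieRing g] [LieAlgebra F g]
  [FiniteDimensional F g] {B : LinearMap.BilinForm F g} {t : Fin 3 → g} {x₀ x₁ : g}

/-- The degenerate Gram matrix: normalize `q = [x₀, x₁]` to be isotropic and take `x₂ = q`. -/
theorem exists_isAdaptedFrame_of_gram_zero (hB : IsInvariantMetric B)
    (ht : IsHeisenbergCoframe B t) (hdim : 9 ≤ finrank F g) (hx : IsLift B t x₀ x₁)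
    (h00 : B x₀ x₀ = 0) (h01 : B x₀ x₁ = 0) (h11 : B x₁ x₁ = 0)
    (hqq : B ⁅x₀, x₁⁆ ⁅x₀, x₁⁆ = 0) (hS11 : B ⁅x₁, ⁅x₀, x₁⁆⁆ ⁅x₁, ⁅x₀, x₁⁆⁆ = 1)
    (hS01 : B ⁅x₀, ⁅x₀, x₁⁆⁆ ⁅x₁, ⁅x₀, x₁⁆⁆ = 0) (hS00 : B ⁅x₀, ⁅x₀, x₁⁆⁆ ⁅x₀, ⁅x₀, x₁⁆⁆ = 0) :
    ∃ x v : Fin 3 → g, IsAdaptedFrame B ![1, 0, 0] t x v := by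
  have hq0 : B (t 0) ⁅x₀, x₁⁆ = 0 := ht.apply_zero_lie hB _ _
  have hq1 : B (t 1) ⁅x₀, x₁⁆ = 0 := ht.apply_one_lie hB _ _
  have hq2 : B (t 2) ⁅x₀, x₁⁆ = 1 := ht.apply_two_lie_lift hB hx
  have hx0q : B x₀ ⁅x₀, x₁⁆ = 0 := hB.apply_lie_self_left _ _
  have hx1q : B x₁ ⁅x₀, x₁⁆ = 0 := hB.apply_lie_self_right _ _
  have hv := ht.apply_lie_lie hB x₁ x₀ x₁
  have h0 : ⁅x₀, ⁅x₀, x₁⁆⁆ = 0 := by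
    refine ht.eq_zero_of_apply hB hx ?_ ?_ ?_ (ht.apply_lie_eq_zero_of_gram hB hx x₀ hS00 hS01)
    · rw [hB.comm, hB.apply_lie_self_left]
    · rw [hB.comm, hB.lie_right, ← lie_skew, map_neg, LinearMap.neg_apply, hqq, neg_zero]
    · rw [hB.invariant, lie_self, map_zero]
  generalize hqdef : ⁅x₀, x₁⁆ = q at *
  have hx0v : B x₀ ⁅x₁, q⁆ = 0 := by rw [hB.lie_right, hqdef, hqq]
  have hx1v : B x₁ ⁅x₁, q⁆ = 0 := hB.apply_lie_self_left _ _
  have hqv : B q ⁅x₁, q⁆ = 0 := hB.apply_lie_self_right _ _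
  have htx : ∀ k l, B (t k) (![x₀, x₁, q] l) = if k = l then 1 else 0 := by
    intro k l
    fin_cases k <;> fin_cases l <;>
    simp [hx.zero_left, hx.one_left, hx.two_left, hx.zero_right, hx.one_right, hx.two_right, hq0,
      hq1, hq2]
  have hxx : ∀ k l, B (![x₀, x₁, q] k) (![x₀, x₁, q] l) = 0 := by
    intro k l
    fin_cases k <;> fin_cases l <;>
    simp [h00, h01, h11, hqq, hx0q, hx1q, hB.comm q x₀, hB.comm q x₁, hB.comm x₁ x₀]
  obtain ⟨U, hmem, hU, hUdim⟩ :=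
    exists_hyperbolic_complement hB.symm hB.nondegenerate ht.isotropic hxx htx
  set v₀ := ⁅x₁, q⁆ with hv₀
  have hvU : v₀ ∈ U := (hmem v₀).2 ⟨hv, fun k => by fin_cases k <;> simp [hx0v, hx1v, hqv]⟩
  obtain ⟨hU₁, hdim₁⟩ := nondegenerate_inf_ker hB.symm hU hvU hS11
  obtain ⟨v₁, hv₁, hv₁₁⟩ := exists_unit_vector hB.symm hU₁ (by omega)
  obtain ⟨hU₂, hdim₂⟩ := nondegenerate_inf_ker hB.symm hU₁ hv₁ hv₁₁
  obtain ⟨v₂, ⟨⟨hv₂, hv₀₂⟩, hv₁₂⟩, hv₂₂⟩ := exists_unit_vector hB.symm hU₂ (by omega)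
  obtain ⟨hv₁, hv₀₁⟩ := hv₁
  rw [SetLike.mem_coe, LinearMap.mem_ker] at hv₀₁ hv₀₂ hv₁₂
  have hvec : ∀ l, (![v₀, v₁, v₂] l) ∈ U := by
    intro l
    fin_cases l
    exacts [hvU, hv₁, hv₂]
  refine ⟨![x₀, x₁, q], ![v₀, v₁, v₂], ht, htx, hxx, fun k l => ((hmem _).1 (hvec l)).1 k,
    fun k l => ((hmem _).1 (hvec l)).2 k, ?_, ?_, ?_, ?_⟩
  · intro k l
    fin_cases k <;> fin_cases l <;>
    simp [hS11, hv₁₁, hv₂₂, hv₀₁, hv₀₂, hv₁₂, hB.comm v₁ v₀, hB.comm v₂ v₀, hB.comm v₂ v₁]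
  · simp [hqdef]
  · simp [hv₀]
  · simp only [Matrix.cons_val, zero_smul]
    rw [← lie_skew, h0, neg_zero]

/-- The nondegenerate Gram matrix: normalize `q = [x₀, x₁]` to be a unit vector and split
`q = x₂ + v₂` with `v₂ = w + t 2`, for a unit vector `w` orthogonal to everything chosen so far;
such a `w` is central. -/
theorem exists_isAdaptedFrame_of_gram_one (hB : IsInvariantMetric B)
    (ht : IsHeisenbergCoframe B t) (hdim : 9 ≤ finrank F g) (hx : IsLift B t x₀ x₁)
    (h00 : B x₀ x₀ = 0) (h01 : B x₀ x₁ = 0) (h11 : B x₁ x₁ = 0)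
    (hqq : B ⁅x₀, x₁⁆ ⁅x₀, x₁⁆ = 1) (hS11 : B ⁅x₁, ⁅x₀, x₁⁆⁆ ⁅x₁, ⁅x₀, x₁⁆⁆ = 1)
    (hS01 : B ⁅x₀, ⁅x₀, x₁⁆⁆ ⁅x₁, ⁅x₀, x₁⁆⁆ = 0) (hS00 : B ⁅x₀, ⁅x₀, x₁⁆⁆ ⁅x₀, ⁅x₀, x₁⁆⁆ = 1) :
    ∃ x v : Fin 3 → g, IsAdaptedFrame B ![1, 1, 1] t x v := by
  have hq0 : B (t 0) ⁅x₀, x₁⁆ = 0 := ht.apply_zero_lie hB _ _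
  have hq1 : B (t 1) ⁅x₀, x₁⁆ = 0 := ht.apply_one_lie hB _ _
  have hq2 : B (t 2) ⁅x₀, x₁⁆ = 1 := ht.apply_two_lie_lift hB hx
  have hx0q : B x₀ ⁅x₀, x₁⁆ = 0 := hB.apply_lie_self_left _ _
  have hx1q : B x₁ ⁅x₀, x₁⁆ = 0 := hB.apply_lie_self_right _ _
  have hy1 := ht.apply_lie_lie hB x₁ x₀ x₁
  have hy0 := ht.apply_lie_lie hB x₀ x₀ x₁
  have hcenter := fun u hu h₂ h₀ h₁ => ht.center_of_apply hB hx (u := u) hu h₂ h₀ h₁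
  generalize hqdef : ⁅x₀, x₁⁆ = q at *
  have t0 := hx.zero_left
  have t1 := hx.one_left
  have t2 := hx.two_left
  have t0' := hx.zero_right
  have t1' := hx.one_right
  have t2' := hx.two_right
  have htq : ∀ k y, B y (t k) = B (t k) y := fun k y => hB.comm _ _
  have hx0y0 : B x₀ ⁅x₀, q⁆ = 0 := hB.apply_lie_self_left _ _
  have hx1y0 : B x₁ ⁅x₀, q⁆ = -1 := by
    rw [hB.lie_right, ← lie_skew, hqdef, map_neg, LinearMap.neg_apply, hqq]
  have hqy0 : B q ⁅x₀, q⁆ = 0 := hB.apply_lie_self_right _ _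
  have hx0y1 : B x₀ ⁅x₁, q⁆ = 1 := by rw [hB.lie_right, hqdef, hqq]
  have hx1y1 : B x₁ ⁅x₁, q⁆ = 0 := hB.apply_lie_self_left _ _
  have hqy1 : B q ⁅x₁, q⁆ = 0 := hB.apply_lie_self_right _ _
  -- the isotropic correction of `q` is only used to find `w`
  have htx : ∀ k l, B (t k) (![x₀, x₁, q - (1 / 2 : F) • t 2] l) = if k = l then 1 else 0 := by
    intro k l
    fin_cases k <;> fin_cases l <;>
    simp [t0, t1, t2, t0', t1', t2', hq0, hq1, hq2, ht.isotropic]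
  have hxx : ∀ k l, B (![x₀, x₁, q - (1 / 2 : F) • t 2] k)
      (![x₀, x₁, q - (1 / 2 : F) • t 2] l) = 0 := by
    intro k l
    fin_cases k <;> fin_cases l <;>
    simp [h00, h01, h11, hqq, hx0q, hx1q, hB.comm q x₀, hB.comm q x₁, hB.comm x₁ x₀, htq, t2, t2',
      hq2, ht.isotropic]
    norm_num
  obtain ⟨U, hmem, hU, hUdim⟩ :=
    exists_hyperbolic_complement hB.symm hB.nondegenerate ht.isotropic hxx htx
  have hmem' : ∀ u, u ∈ U ↔ (∀ k, B (t k) u = 0) ∧ B x₀ u = 0 ∧ B x₁ u = 0 ∧ B q u = 0 := by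
    intro u
    rw [hmem]
    refine and_congr_right fun h => ?_
    simp [Fin.forall_fin_succ, h]
  set v₀ := ⁅x₁, q⁆ - t 0 with hv₀
  set v₁ := -⁅x₀, q⁆ - t 1 with hv₁
  have hv₀U : v₀ ∈ U := (hmem' _).2 ⟨fun k => by simp [hv₀, hy1, ht.isotropic],
    by simp [hv₀, hx0y1, htq, t0], by simp [hv₀, hx1y1, htq, t0'], by simp [hv₀, hqy1, htq, hq0]⟩
  have hv₁U : v₁ ∈ U := (hmem' _).2 ⟨fun k => by simp [-lie_skew, hv₁, hy0, ht.isotropic],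
    by simp [-lie_skew, hv₁, hx0y0, htq, t1], by simp [-lie_skew, hv₁, hx1y0, htq, t1'], by simp [-lie_skew, hv₁, hqy0, htq, hq1]⟩
  have hv₀₀ : B v₀ v₀ = 1 := by simp [hv₀, hS11, htq, hy1, ht.isotropic]
  have hv₁₁ : B v₁ v₁ = 1 := by simp [-lie_skew, hv₁, hS00, htq, hy0, ht.isotropic]
  have hv₀₁ : B v₀ v₁ = 0 := by
    have e : B ⁅x₁, q⁆ ⁅x₀, q⁆ = 0 := (hB.comm _ _).trans hS01
    simp [-lie_skew, hv₀, hv₁, e, htq _ ⁅x₁, q⁆, hy0, hy1, ht.isotropic]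
  obtain ⟨hU₁, hdim₁⟩ := nondegenerate_inf_ker hB.symm hU hv₀U hv₀₀
  obtain ⟨hU₂, hdim₂⟩ := nondegenerate_inf_ker hB.symm hU₁ (w := v₁) ⟨hv₁U, hv₀₁⟩ hv₁₁
  obtain ⟨w, ⟨⟨hwU, hv₀w⟩, hv₁w⟩, hww⟩ := exists_unit_vector hB.symm hU₂ (by omega)
  rw [SetLike.mem_coe, LinearMap.mem_ker] at hv₀w hv₁w
  obtain ⟨htw, hx0w, hx1w, hqw⟩ := (hmem' w).1 hwU
  obtain ⟨htv₀, hx0v₀, hx1v₀, hqv₀⟩ := (hmem' v₀).1 hv₀U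
  obtain ⟨htv₁, hx0v₁, hx1v₁, hqv₁⟩ := (hmem' v₁).1 hv₁U
  have hwq : B w q = 0 := (hB.comm _ _).trans hqw
  have hwcen : ∀ y : g, ⁅y, w⁆ = 0 := by
    refine hcenter w htw hwq ?_ ?_
    · have : B v₁ w = 0 := hv₁w
      rw [hB.comm]
      simpa [-lie_skew, hv₁, htw] using this
    · have : B v₀ w = 0 := hv₀w
      rw [hB.comm]
      simpa [hv₀, htw] using this
  have hwcen' : ∀ y : g, ⁅w, y⁆ = 0 := fun y => by rw [← lie_skew, hwcen, neg_zero]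
  refine ⟨![x₀, x₁, q - w - t 2], ![v₀, v₁, w + t 2], ht, ?_, ?_, ?_, ?_, ?_, ?_, ?_, ?_⟩
  · intro k l
    fin_cases k <;> fin_cases l <;>
    simp [t0, t1, t2, t0', t1', t2', hq0, hq1, hq2, htw, ht.isotropic]
  · intro k l
    fin_cases k <;> fin_cases l <;>
    simp [h00, h01, h11, hqq, hx0q, hx1q, hB.comm q x₀, hB.comm q x₁, hB.comm x₁ x₀, htq, t2, t2',
      hq2, ht.isotropic, hx0w, hx1w, hqw, hwq, hB.comm w x₀, hB.comm w x₁, htw, hww]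
  · intro k l
    fin_cases l <;> simp [htv₀, htv₁, htw, ht.isotropic]
  · intro k l
    fin_cases k <;> fin_cases l <;>
    simp [hx0v₀, hx1v₀, hqv₀, hx0v₁, hx1v₁, hqv₁, hx0w, hx1w, hqw, htv₀, htv₁, htw, htq, t2, t2',
      hq2, ht.isotropic, hB.comm w v₀, hB.comm w v₁, hv₀w, hv₁w, hww]
  · intro k l
    fin_cases k <;> fin_cases l <;>
    simp [hv₀₀, hv₁₁, hv₀₁, hB.comm v₁ v₀, hv₀w, hv₁w, hB.comm w v₀, hB.comm w v₁, hww, htq, htv₀,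
      htv₁, htw, ht.isotropic]
  · simp [hqdef]
  · simp [hv₀, hwcen, ht.lie_two, t0', t1']
  · have e : ⁅t 2, x₀⁆ = t 1 := by rw [← lie_skew, ht.lie_two, t0, t1]; simp
    simp [hv₁, hwcen', e]

theorem exists_isAdaptedFrame (hB : IsInvariantMetric B) (ht : IsHeisenbergCoframe B t)
    (hdim : 9 ≤ finrank F g) :
    ∃ (ε : Fin 3 → F) (t x v : Fin 3 → g), (ε = ![1, 1, 1] ∨ ε = ![1, 0, 0]) ∧
      IsAdaptedFrame B ε t x v := by
  obtain ⟨t, p₀, p₁, ht, hp, h1, h2, h3⟩ := ht.exists_normalized_gram hB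
  rcases h3 with h3 | h3
  · obtain ⟨x₀, x₁, hx, h00, h01, h11, hqq, hS11, hS01, hS00⟩ :=
      ht.exists_isotropic_lift hB hp h1 0
    obtain ⟨x, v, h⟩ := ht.exists_isAdaptedFrame_of_gram_zero hB hdim hx h00 h01 h11 hqq hS11
      (hS01.trans h2) (hS00.trans h3)
    exact ⟨_, t, x, v, Or.inr rfl, h⟩
  · obtain ⟨x₀, x₁, hx, h00, h01, h11, hqq, hS11, hS01, hS00⟩ :=
      ht.exists_isotropic_lift hB hp h1 1
    obtain ⟨x, v, h⟩ := ht.exists_isAdaptedFrame_of_gram_one hB hdim hx h00 h01 h11 hqq hS11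
      (hS01.trans h2) (hS00.trans h3)
    exact ⟨_, t, x, v, Or.inl rfl, h⟩

end IsHeisenbergCoframe

/-! ### The model algebras -/

namespace Heisenberg

variable {F : Type*} [Field F]

/-- The cross product of coordinate vectors.  Its entries are the coefficients with which the
values of an alternating bilinear map at `(x₂, x₃)`, `(x₃, x₁)`, `(x₁, x₂)` enter its value at
`(x, y)`. -/
def cross (x y : Heisenberg F) : Fin 3 → F :=
  ![x 1 * y 2 - x 2 * y 1, x 2 * y 0 - x 0 * y 2, x 0 * y 1 - x 1 * y 0]

theorem dual_ext {α β : Dual F (Heisenberg F)}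
    (h : ∀ k, α (basisVec F k) = β (basisVec F k)) : α = β :=
  (Pi.basisFun F (Fin 3)).ext fun k => by
    rw [Pi.basisFun_apply]
    exact h k

theorem sum_smul_dualVec_apply (c : Fin 3 → F) (x : Heisenberg F) :
    (∑ k, c k • dualVec F k) x = ∑ k, c k * x k := by
  rw [LinearMap.sum_apply]
  rfl

theorem eq_sum_smul_dualVec (α : Dual F (Heisenberg F)) :
    ∑ k, α (basisVec F k) • dualVec F k = α :=
  dual_ext fun l => by
    rw [sum_smul_dualVec_apply]
    simp [basisVec, Pi.single_apply]

theorem lie_dual_apply (x y : Heisenberg F) (α : Dual F (Heisenberg F)) :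
    ⁅x, α⁆ y = - α ⁅x, y⁆ := by
  simp

end Heisenberg

/-- The cochain `λ` with diagonal matrix `diag(ε)`. -/
def diagonalLam {F : Type*} [Field F] (ε : Fin 3 → F) :
    Heisenberg F →ₗ[F] Heisenberg F →ₗ[F] (Fin 3 → F) :=
  LinearMap.mk₂ F (fun x y k => ε k * Heisenberg.cross x y k)
    (fun x x' y => by
      ext k; fin_cases k <;> simp [Heisenberg.cross, Heisenberg.add_apply] <;> ring)
    (fun c x y => by
      ext k; fin_cases k <;> simp [Heisenberg.cross, Heisenberg.smul_apply] <;> ring)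
    (fun x y y' => by
      ext k; fin_cases k <;> simp [Heisenberg.cross, Heisenberg.add_apply] <;> ring)
    (fun c x y => by
      ext k; fin_cases k <;> simp [Heisenberg.cross, Heisenberg.smul_apply] <;> ring)

theorem diagonalLam_apply {F : Type*} [Field F] (ε : Fin 3 → F) (x y : Heisenberg F) (k : Fin 3) :
    diagonalLam ε x y k = ε k * Heisenberg.cross x y k := rfl

/-- The map `φ` determined by `λ = diag(ε)` through `φ(x)(v)(y) = -⟨v, λ(x, y)⟩`, the relation
that invariance of the metric requires. -/
def diagonalPhi {F : Type*} [Field F] (ε : Fin 3 → F) :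
    Heisenberg F →ₗ[F] (Fin 3 → F) →ₗ[F] Dual F (Heisenberg F) :=
  LinearMap.mk₂ F (fun x v => -(standardForm F 3 v ∘ₗ diagonalLam ε x))
    (fun x x' v => by rw [map_add, LinearMap.comp_add, neg_add])
    (fun c x v => by rw [map_smul, LinearMap.comp_smul, smul_neg])
    (fun x v v' => by rw [map_add, LinearMap.add_comp, neg_add])
    (fun c x v => by rw [map_smul, LinearMap.smul_comp, smul_neg])

theorem diagonalPhi_apply {F : Type*} [Field F] (ε : Fin 3 → F) (x y : Heisenberg F)
    (v : Fin 3 → F) :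
    diagonalPhi ε x v y = -∑ k, v k * (ε k * Heisenberg.cross x y k) := rfl

/-- The data `(λ, μ, φ)` over the Heisenberg algebra with `λ = diag(ε)`, `μ = 0` and `φ`
determined by `λ`. -/
def diagonalData {F : Type*} [Field F] (ε : Fin 3 → F) :
    ExtensionData F (Heisenberg F) (Fin 3 → F) where
  lam := diagonalLam ε
  mu := 0
  phi := diagonalPhi ε
  lam_self x := by
    ext k
    rw [diagonalLam_apply]
    fin_cases k <;> simp [Heisenberg.cross, mul_comm]
  mu_self _ := rfl
  phi_cocycle x y v := by
    refine LinearMap.ext fun z => ?_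
    rw [LinearMap.sub_apply, Heisenberg.lie_dual_apply, Heisenberg.lie_dual_apply]
    simp only [diagonalPhi_apply, Fin.sum_univ_three, Heisenberg.cross, Heisenberg.bracket_apply,
      Matrix.cons_val, Fin.reduceEq, if_true, if_false]
    ring
  lam_cocycle x y z := by
    ext k
    rw [Pi.add_apply, Pi.add_apply, diagonalLam_apply, diagonalLam_apply, diagonalLam_apply]
    fin_cases k <;>
    simp only [Heisenberg.cross, Heisenberg.bracket_apply, Matrix.cons_val, Fin.reduceEq, if_true,
      if_false, Pi.zero_apply, Fin.reduceFinMk, Fin.zero_eta, Fin.mk_one] <;>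
    ring
  mu_cocycle x y z := by
    refine LinearMap.ext fun u => ?_
    simp only [LinearMap.zero_apply, lie_zero, add_zero, sub_zero, zero_add, LinearMap.add_apply,
      diagonalPhi_apply, diagonalLam_apply, Fin.sum_univ_three, Heisenberg.cross, Matrix.cons_val]
    ring

section diagonalData

variable {F : Type*} [Field F] (ε : Fin 3 → F)

theorem diagonalData_lam_apply (x y : Heisenberg F) (k : Fin 3) :
    (diagonalData ε).lam x y k = ε k * Heisenberg.cross x y k := rfl

theorem diagonalData_mu : (diagonalData ε).mu = 0 := rfl

theorem diagonalData_phi_apply (x y : Heisenberg F) (v : Fin 3 → F) :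
    (diagonalData ε).phi x v y = -∑ k, v k * (ε k * Heisenberg.cross x y k) := rfl

theorem diagonalData_toDual_lie_apply (p q : (diagonalData ε).Algebra) (u : Heisenberg F) :
    (diagonalData ε).toDual ⁅p, q⁆ u =
      (diagonalData ε).phi ((diagonalData ε).toH p) ((diagonalData ε).toA q) u
        - (diagonalData ε).phi ((diagonalData ε).toH q) ((diagonalData ε).toA p) u
        - (diagonalData ε).toDual q ⁅(diagonalData ε).toH p, u⁆
        + (diagonalData ε).toDual p ⁅(diagonalData ε).toH q, u⁆ := by
  have e : (diagonalData ε).toDual ⁅p, q⁆ u = 0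
      + ((diagonalData ε).phi ((diagonalData ε).toH p) ((diagonalData ε).toA q) u
        - (diagonalData ε).phi ((diagonalData ε).toH q) ((diagonalData ε).toA p) u)
      + (⁅(diagonalData ε).toH p, (diagonalData ε).toDual q⁆ u
        - ⁅(diagonalData ε).toH q, (diagonalData ε).toDual p⁆ u) := rfl
  rw [e, Heisenberg.lie_dual_apply, Heisenberg.lie_dual_apply]
  ring

theorem diagonalData_isQuadraticCase {ε : Fin 3 → F} (h : ε = ![1, 1, 1] ∨ ε = ![1, 0, 0]) :
    (diagonalData ε).IsQuadraticCase := by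
  rcases h with rfl | rfl
  · refine Or.inl ⟨fun j => ?_, fun j => ?_, fun j l => ?_⟩
    · ext i
      rw [diagonalData_lam_apply]
      fin_cases j <;> fin_cases i <;> simp [Heisenberg.cross, Heisenberg.basisVec]
    · simp [diagonalData_mu]
    · refine Heisenberg.dual_ext fun i => ?_
      rw [diagonalData_phi_apply, Heisenberg.sum_smul_dualVec_apply]
      fin_cases j <;> fin_cases l <;> fin_cases i <;>
      simp [Heisenberg.cross, Heisenberg.basisVec, Fin.sum_univ_three]
  · refine Or.inr (Or.inl ⟨fun j => ?_, fun j => ?_, fun j l => ?_⟩)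
    · ext i
      rw [diagonalData_lam_apply]
      fin_cases j <;> fin_cases i <;> simp [Heisenberg.cross, Heisenberg.basisVec]
    · simp [diagonalData_mu]
    · refine Heisenberg.dual_ext fun i => ?_
      rw [diagonalData_phi_apply, Heisenberg.sum_smul_dualVec_apply]
      fin_cases j <;> fin_cases l <;> fin_cases i <;>
      simp [Heisenberg.cross, Heisenberg.basisVec, Fin.sum_univ_three]

end diagonalData

/-! ### The isometry defined by an adapted frame -/

namespace IsAdaptedFrame

variable {F g : Type*} [Field F] [LieRing g] [LieAlgebra F g] {B : LinearMap.BilinForm F g}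
  {ε : Fin 3 → F} {t x v : Fin 3 → g}

/-- The coordinates of `z` along the lifts `x`. -/
def coord (B : LinearMap.BilinForm F g) (t : Fin 3 → g) (z : g) : Heisenberg F :=
  fun k => B (t k) z

theorem exists_decomposition (h : IsAdaptedFrame B ε t x v) (z : g) :
    ∃ z', (∀ k, B (t k) z' = 0) ∧
      z = B (t 0) z • x 0 + B (t 1) z • x 1 + B (t 2) z • x 2 + z' := by
  refine ⟨z - (B (t 0) z • x 0 + B (t 1) z • x 1 + B (t 2) z • x 2), fun k => ?_, by abel⟩
  fin_cases k <;> simp [h.tx]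

/-- On the common kernel of the functionals `B(t k, ·)` the bracket is seen through the brackets
of the lifts only. -/
theorem apply_lie_of_ker (hB : IsInvariantMetric B) (h : IsAdaptedFrame B ε t x v) {u : g}
    (hu : ∀ k, B (t k) u = 0) (y z : g) :
    B u ⁅y, z⁆ = (coord B t y).cross (coord B t z) 2 * B u (x 2)
      + ∑ k, ε k * (coord B t y).cross (coord B t z) k * B u (v k) := by
  obtain ⟨y', hy', ey⟩ := h.exists_decomposition y
  obtain ⟨z', hz', ez⟩ := h.exists_decomposition z
  have a1 : ∀ z, B u ⁅y', z⁆ = 0 := fun z => by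
    rw [hB.comm]; exact h.coframe.apply_lie_of_ker' hB z hy' hu
  have a2 : ∀ y, B u ⁅y, z'⁆ = 0 := fun y => by
    rw [hB.comm]; exact h.coframe.apply_lie_of_ker hB y hz' hu
  have b01 : B u ⁅x 1, x 0⁆ = -(B u (x 2) + ε 2 * B u (v 2)) := by
    rw [← lie_skew, h.lie_zero_one]; simp
  have b12 : B u ⁅x 2, x 1⁆ = -(ε 0 * B u (v 0)) := by
    rw [← lie_skew, h.lie_one_two]; simp
  have b20 : B u ⁅x 0, x 2⁆ = -(ε 1 * B u (v 1)) := by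
    rw [← lie_skew, h.lie_two_zero]; simp
  have e : B u ⁅y, z⁆ = B u ⁅B (t 0) y • x 0 + B (t 1) y • x 1 + B (t 2) y • x 2 + y',
      B (t 0) z • x 0 + B (t 1) z • x 1 + B (t 2) z • x 2 + z'⁆ := by rw [← ey, ← ez]
  rw [e]
  simp only [add_lie, lie_add, smul_lie, lie_smul, map_add, map_smul, a1, a2, b01, b12, b20,
    h.lie_zero_one, h.lie_one_two, h.lie_two_zero, lie_self, map_zero, smul_eq_mul,
    Fin.sum_univ_three, Heisenberg.cross, coord, Matrix.cons_val]
  ring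

/-- The components of `[y, z]` along `a`. -/
theorem apply_vec_lie (hB : IsInvariantMetric B) (h : IsAdaptedFrame B ε t x v) (y z : g)
    (k : Fin 3) : B (v k) ⁅y, z⁆ = ε k * (coord B t y).cross (coord B t z) k := by
  rw [h.apply_lie_of_ker hB (fun l => h.tv l k), hB.comm, h.xv]
  simp [h.vv]

/-- The components of `[y, z]` along `h*`, i.e. its products with the lifts `x`. -/
theorem apply_lift_lie (hB : IsInvariantMetric B) (h : IsAdaptedFrame B ε t x v) (y z : g)
    (k : Fin 3) :
    B (x k) ⁅y, z⁆ =
      (coord B t z).cross (Heisenberg.basisVec F k) 2 * B (x 2) y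
        - (coord B t y).cross (Heisenberg.basisVec F k) 2 * B (x 2) z
        + ∑ l, ε l * B (v l) y * (coord B t z).cross (Heisenberg.basisVec F k) l
        - ∑ l, ε l * B (v l) z * (coord B t y).cross (Heisenberg.basisVec F k) l := by
  obtain ⟨y', hy', ey⟩ := h.exists_decomposition y
  have hxy : B y' (x 2) = B (x 2) y := by
    rw [ey, hB.comm y']; simp [h.xx]
  have hvy : ∀ l, B y' (v l) = B (v l) y := fun l => by
    rw [ey, hB.comm y']; simp [hB.comm (v l) (x _), h.xv]
  have hc : coord B t (x k) = Heisenberg.basisVec F k := by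
    ext l; simp [coord, h.tx, Heisenberg.basisVec, Pi.single_apply]
  have e : B (x k) ⁅y, z⁆ = B (t 0) y * B ⁅x k, x 0⁆ z + B (t 1) y * B ⁅x k, x 1⁆ z
      + B (t 2) y * B ⁅x k, x 2⁆ z - B y' ⁅x k, z⁆ := by
    rw [hB.lie_right, hB.lie_right y', ← lie_skew y' (x k)]
    conv_lhs => rw [ey]
    simp [-lie_skew]
  have b01 : ⁅x 1, x 0⁆ = -(x 2 + ε 2 • v 2) := by rw [← lie_skew, h.lie_zero_one]
  have b12 : ⁅x 2, x 1⁆ = -(ε 0 • v 0) := by rw [← lie_skew, h.lie_one_two]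
  have b20 : ⁅x 0, x 2⁆ = -(ε 1 • v 1) := by rw [← lie_skew, h.lie_two_zero]
  rw [e, h.apply_lie_of_ker hB hy', hc, hxy]
  simp only [hvy]
  fin_cases k <;>
  simp [b01, b12, b20, h.lie_zero_one, h.lie_one_two, h.lie_two_zero, Fin.sum_univ_three,
    Heisenberg.cross, Heisenberg.basisVec, coord] <;> ring

/-- The component of `z` in `h ⊕ a ⊕ h*`. -/
def toModel (B : LinearMap.BilinForm F g) (ε : Fin 3 → F) (t x v : Fin 3 → g) :
    g →ₗ[F] (diagonalData ε).Algebra where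
  toFun z := (diagonalData ε).elt (coord B t z) (fun k => B (v k) z)
    (∑ k, B (x k) z • Heisenberg.dualVec F k)
  map_add' y z := by
    ext1
    · exact Heisenberg.ext fun k => by simp [coord, Heisenberg.add_apply]
    · ext k; simp
    · simp [add_smul, Finset.sum_add_distrib]
  map_smul' c z := by
    ext1
    · exact Heisenberg.ext fun k => by simp [coord, Heisenberg.smul_apply]
    · ext k; simp
    · simp [mul_smul, Finset.smul_sum]

theorem toH_toModel (z : g) : (diagonalData ε).toH (toModel B ε t x v z) = coord B t z := rfl

theorem toA_toModel (z : g) :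
    (diagonalData ε).toA (toModel B ε t x v z) = fun k => B (v k) z := rfl

theorem toDual_toModel (z : g) :
    (diagonalData ε).toDual (toModel B ε t x v z) = ∑ k, B (x k) z • Heisenberg.dualVec F k := rfl

/-- The adapted frame gives a homomorphism onto the model. -/
theorem toModel_lie (hB : IsInvariantMetric B) (h : IsAdaptedFrame B ε t x v) (y z : g) :
    toModel B ε t x v ⁅y, z⁆ = ⁅toModel B ε t x v y, toModel B ε t x v z⁆ := by
  rw [ExtensionData.bracket_def]
  ext1
  · refine Heisenberg.ext fun k => ?_
    rw [ExtensionData.toH_elt, Heisenberg.bracket_apply]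
    have h0 := h.coframe.apply_zero_lie hB y z
    have h1 := h.coframe.apply_one_lie hB y z
    have h2 := h.coframe.apply_two_lie hB y z
    fin_cases k
    · exact h0
    · exact h1
    · exact h2
  · ext k
    exact h.apply_vec_lie hB y z k
  · refine Heisenberg.dual_ext fun k => ?_
    rw [← ExtensionData.bracket_def, diagonalData_toDual_lie_apply]
    simp only [toH_toModel, toA_toModel, toDual_toModel, Heisenberg.sum_smul_dualVec_apply]
    have e : ∑ l, B (x l) ⁅y, z⁆ * Heisenberg.basisVec F k l = B (x k) ⁅y, z⁆ := by
      simp [Heisenberg.basisVec, Pi.single_apply]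
    rw [e, h.apply_lift_lie hB]
    simp only [diagonalData_phi_apply, Fin.sum_univ_three, Heisenberg.cross, Heisenberg.bracket_apply, Matrix.cons_val,
      Fin.reduceEq, if_true, if_false]
    ring

/-- The part of `g` orthogonal to an adapted frame. -/
def frameOrthogonal (B : LinearMap.BilinForm F g) (t x v : Fin 3 → g) : Submodule F g :=
  LinearMap.ker (LinearMap.pi fun k => B (t k)) ⊓ LinearMap.ker (LinearMap.pi fun k => B (x k))
    ⊓ LinearMap.ker (LinearMap.pi fun k => B (v k))

theorem mem_frameOrthogonal {w : g} : w ∈ frameOrthogonal B t x v ↔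
    ((∀ k, B (t k) w = 0) ∧ ∀ k, B (x k) w = 0) ∧ ∀ k, B (v k) w = 0 := by
  simp [frameOrthogonal, funext_iff]

theorem xt (hB : IsInvariantMetric B) (h : IsAdaptedFrame B ε t x v) (k l : Fin 3) :
    B (x k) (t l) = if k = l then 1 else 0 := by
  rw [hB.comm, h.tx]; simp only [eq_comm]

/-- The orthogonal projection onto `frameOrthogonal`. -/
def frameProjection (hB : IsInvariantMetric B) (h : IsAdaptedFrame B ε t x v) :
    g →ₗ[F] frameOrthogonal B t x v :=
  LinearMap.codRestrict _
    (LinearMap.id - ∑ k, (B (t k)).smulRight (x k) - ∑ k, (B (x k)).smulRight (t k)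
      - ∑ k, (B (v k)).smulRight (v k))
    fun z => mem_frameOrthogonal.2 ⟨⟨fun k => by
        simp [h.tx, h.tv, h.coframe.isotropic], fun k => by simp [h.xx, h.xt hB, h.xv]⟩,
      fun k => by simp [hB.comm (v k) (x _), hB.comm (v k) (t _), h.xv, h.tv, h.vv]⟩

theorem coe_frameProjection (hB : IsInvariantMetric B) (h : IsAdaptedFrame B ε t x v) (z : g) :
    (h.frameProjection hB z : g) = z - ∑ k, B (t k) z • x k - ∑ k, B (x k) z • t k
      - ∑ k, B (v k) z • v k := by
  simp [frameProjection]

theorem apply_frameProjection (hB : IsInvariantMetric B) (h : IsAdaptedFrame B ε t x v) {w : g}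
    (hw : w ∈ frameOrthogonal B t x v) (z : g) : B w (h.frameProjection hB z) = B w z := by
  obtain ⟨⟨h1, h2⟩, h3⟩ := mem_frameOrthogonal.1 hw
  rw [coe_frameProjection]
  simp [hB.comm w, h1, h2, h3]

theorem eq_zero_of_mem_frameOrthogonal (hB : IsInvariantMetric B) (h : IsAdaptedFrame B ε t x v)
    {w : g} (hw : w ∈ frameOrthogonal B t x v)
    (h0 : ∀ w' ∈ frameOrthogonal B t x v, B w w' = 0) : w = 0 :=
  hB.eq_zero fun z => by
    rw [← h.apply_frameProjection hB hw z]
    exact h0 _ (h.frameProjection hB z).2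

/-- Brackets have no component along `frameOrthogonal`, which is therefore central. -/
theorem frameProjection_lie (hB : IsInvariantMetric B) (h : IsAdaptedFrame B ε t x v) (y z : g) :
    h.frameProjection hB ⁅y, z⁆ = 0 := by
  refine Subtype.ext (h.eq_zero_of_mem_frameOrthogonal hB (h.frameProjection hB ⁅y, z⁆).2
    fun w hw => ?_)
  obtain ⟨⟨h1, h2⟩, h3⟩ := mem_frameOrthogonal.1 hw
  rw [hB.comm, h.apply_frameProjection hB hw, h.apply_lie_of_ker hB h1]
  simp [hB.comm w, h2, h3]

/-- The metric is the orthogonal sum of the metric of the model and its restriction to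
`frameOrthogonal`. -/
theorem form_toModel (hB : IsInvariantMetric B) (h : IsAdaptedFrame B ε t x v) (y z : g) :
    B y z = (diagonalData ε).form (standardForm F 3) (toModel B ε t x v y) (toModel B ε t x v z)
      + B (h.frameProjection hB y) (h.frameProjection hB z) := by
  have e : (diagonalData ε).form (standardForm F 3) (toModel B ε t x v y) (toModel B ε t x v z)
      = ∑ k, B (x k) y * B (t k) z + ∑ k, B (x k) z * B (t k) y + ∑ k, B (v k) y * B (v k) z := by
    have e' : (diagonalData ε).form (standardForm F 3) (toModel B ε t x v y) (toModel B ε t x v z)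
      = (∑ k, B (x k) y • Heisenberg.dualVec F k) (coord B t z)
        + (∑ k, B (x k) z • Heisenberg.dualVec F k) (coord B t y)
        + ∑ k, B (v k) y * B (v k) z := rfl
    rw [e', Heisenberg.sum_smul_dualVec_apply, Heisenberg.sum_smul_dualVec_apply]
    rfl
  rw [e, h.apply_frameProjection hB (h.frameProjection hB y).2, coe_frameProjection]
  simp only [map_sub, map_add, map_smul, LinearMap.sub_apply, LinearMap.add_apply,
    LinearMap.smul_apply, smul_eq_mul, Fin.sum_univ_three]
  ring

theorem exists_preimage (hB : IsInvariantMetric B) (h : IsAdaptedFrame B ε t x v)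
    (p : (diagonalData ε).Algebra) (w : frameOrthogonal B t x v) :
    ∃ z, toModel B ε t x v z = p ∧ h.frameProjection hB z = w := by
  obtain ⟨⟨h1, h2⟩, h3⟩ := mem_frameOrthogonal.1 w.2
  set a : Fin 3 → F := (diagonalData ε).toH p
  set b := (diagonalData ε).toA p
  set c := (diagonalData ε).toDual p
  set z := ∑ k, a k • x k + ∑ k, b k • v k + ∑ k, c (Heisenberg.basisVec F k) • t k + w with hz
  have ht : ∀ k, B (t k) z = a k := fun k => by
    simp [hz, h.tx, h.tv, h.coframe.isotropic, h1]
  have hx : ∀ k, B (x k) z = c (Heisenberg.basisVec F k) := fun k => by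
    simp [hz, h.xx, h.xv, h.xt hB, h2]
  have hv : ∀ k, B (v k) z = b k := fun k => by
    simp [hz, hB.comm (v k) (x _), hB.comm (v k) (t _), h.xv, h.tv, h.vv, h3]
  refine ⟨z, ?_, Subtype.ext ?_⟩
  · ext1
    · exact Heisenberg.ext ht
    · exact funext hv
    · rw [toDual_toModel]
      simp only [hx]
      exact Heisenberg.eq_sum_smul_dualVec c
  · rw [coe_frameProjection]
    simp only [ht, hx, hv]
    rw [hz]
    abel

/-- An adapted frame identifies `g`, up to isometry, with the orthogonal sum of the model and
`frameOrthogonal`. -/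
noncomputable def isometry (hB : IsInvariantMetric B) (h : IsAdaptedFrame B ε t x v) :
    g ≃ₗ[F] (diagonalData ε).Algebra × frameOrthogonal B t x v :=
  LinearEquiv.ofBijective ((toModel B ε t x v).prod (h.frameProjection hB))
    ⟨(injective_iff_map_eq_zero _).2 fun y hy => hB.eq_zero fun z => by
      have h1 : toModel B ε t x v y = 0 := congrArg Prod.fst hy
      have h2 : h.frameProjection hB y = 0 := congrArg Prod.snd hy
      rw [h.form_toModel hB, h1, h2]
      simp,
    fun p => by
      obtain ⟨z, h1, h2⟩ := h.exists_preimage hB p.1 p.2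
      exact ⟨z, Prod.ext h1 h2⟩⟩

theorem isInvariantMetric_form (hB : IsInvariantMetric B) (h : IsAdaptedFrame B ε t x v) :
    IsInvariantMetric ((diagonalData ε).form (standardForm F 3)) := by
  -- the form is the restriction of `B` to the elements with trivial second component
  have hlift : ∀ p : (diagonalData ε).Algebra, ∃ z, toModel B ε t x v z = p ∧
      h.frameProjection hB z = 0 := fun p => h.exists_preimage hB p 0
  have hform : ∀ y z, h.frameProjection hB y = 0 →
      (diagonalData ε).form (standardForm F 3) (toModel B ε t x v y) (toModel B ε t x v z)
        = B y z := fun y z hy => by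
    rw [h.form_toModel hB y z, hy]; simp
  have hsymm : ((diagonalData ε).form (standardForm F 3)).IsSymm := ⟨fun p q => by
    obtain ⟨y, rfl, hy⟩ := hlift p
    obtain ⟨z, rfl, hz⟩ := hlift q
    rw [hform y z hy, hform z y hz, hB.comm]⟩
  refine ⟨hsymm, (hsymm.isRefl.nondegenerate_iff_separatingLeft).2 fun p hp => ?_,
    fun p q s => ?_⟩
  · obtain ⟨y, rfl, hy⟩ := hlift p
    have : y = 0 := hB.eq_zero fun z => by rw [← hform y z hy]; exact hp _
    rw [this, map_zero]
  · obtain ⟨y, rfl, hy⟩ := hlift p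
    obtain ⟨z, rfl, hz⟩ := hlift q
    obtain ⟨u, rfl, hu⟩ := hlift s
    rw [← h.toModel_lie hB, ← h.toModel_lie hB, hform _ _ (h.frameProjection_lie hB y z),
      hform _ _ hy, hB.invariant]

theorem finrank_frameOrthogonal [FiniteDimensional F g] (hB : IsInvariantMetric B)
    (h : IsAdaptedFrame B ε t x v) :
    finrank F g = 9 + finrank F (frameOrthogonal B t x v) := by
  have e1 := (h.isometry hB).finrank_eq
  have e2 : finrank F (diagonalData ε).Algebra
      = finrank F ((Fin 3 → F) × (Fin 3 → F) × Dual F (Fin 3 → F)) := rfl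
  have : FiniteDimensional F (diagonalData ε).Algebra :=
    inferInstanceAs (FiniteDimensional F ((Fin 3 → F) × (Fin 3 → F) × Dual F (Fin 3 → F)))
  rw [finrank_prod, e2] at e1
  rw [e1]
  simp

end IsAdaptedFrame

/-! ### The classification -/

theorem mainTheorem5 {F g : Type*} [Field F] [IsAlgClosed F] [CharZero F]
    [LieRing g] [LieAlgebra F g] [FiniteDimensional F g]
    (B : LinearMap.BilinForm F g) (hB : IsInvariantMetric B)
    (hsolv : LieAlgebra.IsSolvable g)
    (habel : ∃ l : ℕ, IsLieAbelian (descendingCentral F g l))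
    (hheis : Nonempty ((g ⧸ canonicalJ F g) ≃ₗ⁅F⁆ Heisenberg F))
    (r : ℕ) (hr : 3 ≤ r)
    (hdim : Module.finrank F ((canonicalJ F g).toSubmodule ⧸
      (canonicalI F g).toSubmodule.submoduleOf (canonicalJ F g).toSubmodule) = r) :
    ∃ D : ExtensionData F (Heisenberg F) (Fin 3 → F), D.IsQuadraticCase ∧
      IsInvariantMetric (D.form (standardForm F 3)) ∧
      ∃ BV : LinearMap.BilinForm F (Fin (r - 3) → F), BV.IsSymm ∧ BV.Nondegenerate ∧
        ∃ e : g ≃ₗ[F] D.Algebra × (Fin (r - 3) → F),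
          (∀ x y : g, e ⁅x, y⁆ = (⁅(e x).1, (e y).1⁆, 0)) ∧
          (∀ x y : g, B x y = D.form (standardForm F 3) (e x).1 (e y).1 + BV (e x).2 (e y).2) := by
  obtain ⟨f⟩ := hheis
  have hfin := finrank_eq_add_six hB f
  rw [hdim] at hfin
  obtain ⟨t₀, ht₀⟩ := exists_isHeisenbergCoframe hB habel f
  obtain ⟨ε, t, x, v, hε, h⟩ := ht₀.exists_isAdaptedFrame hB (by omega)
  have hW : finrank F (IsAdaptedFrame.frameOrthogonal B t x v) = r - 3 := by
    have := h.finrank_frameOrthogonal hB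
    omega
  let c : IsAdaptedFrame.frameOrthogonal B t x v ≃ₗ[F] (Fin (r - 3) → F) :=
    (finBasisOfFinrankEq F _ hW).equivFun
  have hsymm : (B.restrict (IsAdaptedFrame.frameOrthogonal B t x v)).IsSymm :=
    ⟨fun a b => hB.comm a b⟩
  refine ⟨diagonalData ε, diagonalData_isQuadraticCase hε, h.isInvariantMetric_form hB,
    LinearMap.BilinForm.congr c (B.restrict (IsAdaptedFrame.frameOrthogonal B t x v)),
    ⟨fun a b => hsymm.eq _ _⟩, LinearMap.BilinForm.Nondegenerate.congr c
      ((hsymm.isRefl.nondegenerate_iff_separatingLeft).2 fun w hw =>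
        Subtype.ext (h.eq_zero_of_mem_frameOrthogonal hB w.2 fun w' hw' => hw ⟨w', hw'⟩)),
    h.isometry hB ≪≫ₗ (LinearEquiv.refl F _).prodCongr c, fun y z => ?_, fun y z => ?_⟩
  · refine Prod.ext (h.toModel_lie hB y z) ?_
    exact (congrArg c (h.frameProjection_lie hB y z)).trans c.map_zero
  · rw [h.form_toModel hB]
    simp only [LinearMap.BilinForm.congr_apply, LinearEquiv.trans_apply,
      LinearEquiv.prodCongr_apply, LinearEquiv.symm_apply_apply]
    rfl
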